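/- Let $\alpha:\mathbb R\to(1/2,\infty)$ be any function, let $\lambda>0$, and write $\alpha_+(s,t)=\tfrac12(\alpha(t)+\alpha(s))$, $\alpha_-(s,t)=\tfrac12(\alpha(t)-\alpha(s))$. Let $U(a,b,\cdot)=\Psi(a,b;\cdot)$ be Kummer's function, i.e. the solution on $(0,\infty)$ of $zw''+(b-z)w'-aw=0$ with $w(z)\sim z^{-a}$ as $z\to\infty$, and let $W_{\kappa,\mu}(z)=e^{-z/2}z^{1/2+\mu}U(\tfrac12+\mu-\kappa,1+2\mu,z)$ be the Whittaker function ($\kappa,\mu\in\mathbb R$, $z>0$). A Gaussian white noise $\eta$ on $\mathbb R$ is a centred Gaussian family $\int f\eta\,du$, $f\in L^2(\mathbb R;\mathbb R)$, with covariance $\langle\int f\eta\int g\eta\rangle=\int fg\,du$. Its Fourier transform $\widetilde\eta(k)=\frac1{\sqrt{2\pi}}\int e^{iku}\eta(u)\,du$ is defined by $\int f\widetilde\eta\,dk=\int\widehat f\,\eta\,du$ for $f\in L^2(\mathbb R;\mathbb C)$, where $\widehat f(u)=\frac1{\sqrt{2\pi}}\int e^{iku}f(k)\,dk$ and $\int g\,\eta\,du=\int(\operatorname{Re}g)\,\eta\,du+i\int(\operatorname{Im}g)\,\eta\,du$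 for complex $g\in L^2$. Consider the two multifractional Ornstein–Uhlenbeck processes $$X_t=\frac1{\Gamma(\alpha(t))}\int_{-\infty}^t e^{-\lambda(t-u)}(t-u)^{\alpha(t)-1}\eta(u)\,du,\qquad Z_t=\frac1{\sqrt{2\pi}}\int_{-\infty}^\infty\frac{e^{-ikt}\,\widetilde\eta'(k)\,dk}{(-ik+\lambda)^{\alpha(t)}},\qquad t\in\mathbb R,$$ driven by arbitrary Gaussian white noises $\eta$, $\eta'$ (possibly equal, possibly on different probability spaces). Then: (1) $W_{\kappa,\mu}(z)=W_{\kappa,-\mu}(z)$ for all real $\kappa,\mu$ and $z>0$. (2) For all $s<t$ (in particular whenever $\alpha(s)+\alpha(t)\notin\mathbb Z$), $$\Psi\bigl(\alpha(s),2\alpha_+(s,t);2\lambda(t-s)\bigr)=e^{\lambda(t-s)}\bigl(2\lambda(t-s)\bigr)^{-\alpha_+(s,t)}W_{\alpha_-(s,t),\,\alpha_+(s,t)-\frac12}\bigl(2\lambda(t-s)\bigr)$$ and $$\frac{e^{-\lambda(t-s)}(t-s)^{2\alpha_+(s,t)-1}}{\Gamma(\alpha(t))}\Psi\bigl(\alpha(s),2\alpha_+(s,t);2\lambda(t-s)\bigr)=\frac{(t-s)^{\alpha_+(s,t)-1}}{\Gamma(\alpha(t))(2\lambda)^{\alpha_+(s,t)}}W_{\alpha_-(s,t),\,\frac12-\alpha_+(s,t)}\bigl(2\lambda(t-s)\bigr).$$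 (3) The two kernels are square integrable; $(X_t)$ and $(Z_t)$ are centred Gaussian processes, and each $Z_t$ is almost surely real. (4) For all $s,t$, $$\langle X_tX_s\rangle=\frac{e^{-\lambda(t+s)}}{\Gamma(\alpha(t))\Gamma(\alpha(s))}\int_{-\infty}^{\min(t,s)}(t-u)^{\alpha(t)-1}(s-u)^{\alpha(s)-1}e^{2\lambda u}\,du,\qquad \langle Z_tZ_s\rangle=\frac1{2\pi}\int_{-\infty}^\infty\frac{e^{-ik(t-s)}\,dk}{(-ik+\lambda)^{\alpha(t)}(ik+\lambda)^{\alpha(s)}},$$ and for $s<t$ these equal respectively the left-hand side ($\Psi$ form) and the right-hand side ($W$ form) of the second identity in (2). (5) $\langle X_tX_s\rangle=\langle Z_tZ_s\rangle$ for all $s,t$, and $(X_t)_{t\in\mathbb R}$ and $(Z_t)_{t\in\mathbb R}$ have the same finite-dimensional distributions. -/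

import Mathlib

open MeasureTheory ProbabilityTheory Filter Topology FourierTransform

namespace MOU

noncomputable section

/-! ### The special functions (real parameters, positive argument) -/

/-- `w` is Kummer's function `U(a, b, ·)` on `(0, ∞)`: the solution of Kummer's equation
`z w'' + (b - z) w' - a w = 0` with `w(z) ∼ z ^ (-a)` as `z → ∞`. -/
structure IsKummerU (a b : ℝ) (w : ℝ → ℝ) : Prop where
  differentiableAt : ∀ z, 0 < z → DifferentiableAt ℝ w z
  differentiableAt_deriv : ∀ z, 0 < z → DifferentiableAt ℝ (deriv w) z
  ode : ∀ z, 0 < z → z * deriv (deriv w) z + (b - z) * deriv w z - a * w z = 0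
  asymptotic : Tendsto (fun z : ℝ => z ^ a * w z) atTop (𝓝 1)

open Classical in
/-- The Kummer (confluent hypergeometric) function `U(a, b, z) = Ψ(a, b; z)` for `z > 0`. The
function is determined on `(0, ∞)` by `IsKummerU`, since every solution of Kummer's equation that
is not a multiple of it grows like `exp z * z ^ (a - b)`. -/
def kummerU (a b z : ℝ) : ℝ :=
  if h : ∃ w, IsKummerU a b w then h.choose z else 0

/-- The Whittaker function `W_{κ,μ}(z)` for `z > 0`. -/
def whittakerW (κ μ z : ℝ) : ℝ :=
  Real.exp (-z / 2) * z ^ (1 / 2 + μ) * kummerU (1 / 2 + μ - κ) (1 + 2 * μ) z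

/-! ### White noise and integrals against it -/

/-- The space `L²(ℝ; E)` with respect to Lebesgue measure. -/
abbrev L2 (E : Type) [NormedAddCommGroup E] : Type := Lp E 2 (volume : Measure ℝ)

open Classical in
/-- The class in `L²` of a square integrable function on the line. -/
def toL2 {E : Type} [NormedAddCommGroup E] (f : ℝ → E) : L2 E :=
  if h : MemLp f 2 (volume : Measure ℝ) then h.toLp f else 0

variable {Ω : Type*} [MeasurableSpace Ω]

/-- Gaussian white noise on the line with zero mean and delta-correlated covariance. The random
variable `η f` is `∫ f(u) η(u) du`, so that `⟨η(u) η(v)⟩ = δ(u - v)` reads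
`⟨(η f) (η g)⟩ = ∫ f(u) g(u) du`. -/
structure IsWhiteNoise (η : L2 ℝ → Ω → ℝ) (P : Measure Ω) : Prop where
  isGaussianProcess : IsGaussianProcess η P
  mean_zero : ∀ f, ∫ ω, η f ω ∂P = 0
  covariance : ∀ f g, ∫ ω, η f ω * η g ω ∂P = inner ℝ f g

/-- `∫ f(u) η(u) du` for a square integrable real function `f`. -/
def noiseIntegral (η : L2 ℝ → Ω → ℝ) (f : ℝ → ℝ) (ω : Ω) : ℝ :=
  η (toL2 f) ω

/-- For square integrable `f : ℝ → ℂ`, the function `u ↦ (2π)^(-1/2) ∫ exp(iku) f(k) dk` in `L²`.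
Mathlib's `𝓕⁻ g (u)` is `∫ exp(2πi ξ u) g(ξ) dξ`, whence the substitution `k = 2πξ`. -/
def unitaryFourier (f : ℝ → ℂ) : L2 ℂ :=
  𝓕⁻ (toL2 fun ξ : ℝ => (√(2 * Real.pi) : ℂ) * f (2 * Real.pi * ξ))

/-- `∫ f(k) η̃(k) dk` for a square integrable complex function `f`, where `η̃` is the Fourier
transform `η̃(k) = (2π)^(-1/2) ∫ exp(iku) η(u) du` of the white noise `η`. As for every Fourier
transform of a generalized function, it is `∫ f̂(u) η(u) du` with
`f̂(u) = (2π)^(-1/2) ∫ exp(iku) f(k) dk`. -/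
def spectralIntegral (η : L2 ℝ → Ω → ℝ) (f : ℝ → ℂ) (ω : Ω) : ℂ :=
  (η (Complex.reCLM.compLp (unitaryFourier f)) ω : ℂ)
    + Complex.I * (η (Complex.imCLM.compLp (unitaryFourier f)) ω : ℂ)

/-! ### The two representations of the multifractional Ornstein-Uhlenbeck process -/

/-- The moving-average kernel `u ↦ exp(-λ(t-u)) (t-u)^(α(t)-1) / Γ(α(t))`, `u < t`. -/
def movingAverageKernel (α : ℝ → ℝ) (lam t : ℝ) : ℝ → ℝ :=
  (Set.Iio t).indicator fun u =>
    1 / Real.Gamma (α t) * (Real.exp (-lam * (t - u)) * (t - u) ^ (α t - 1))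

/-- The spectral kernel `k ↦ (2π)^(-1/2) exp(-ikt) / (-ik + λ)^α(t)`. -/
def spectralKernel (α : ℝ → ℝ) (lam t : ℝ) : ℝ → ℂ := fun k =>
  1 / (√(2 * Real.pi) : ℂ) * (Complex.exp (-Complex.I * k * t)
    / (-Complex.I * k + lam) ^ (α t : ℂ))

/-- `X_t = (1/Γ(α(t))) ∫_{-∞}^t exp(-λ(t-u)) (t-u)^(α(t)-1) η(u) du`. -/
def movingAverageMOU (α : ℝ → ℝ) (lam : ℝ) (η : L2 ℝ → Ω → ℝ) (t : ℝ) (ω : Ω) : ℝ :=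
  noiseIntegral η (movingAverageKernel α lam t) ω

/-- `X_t = (2π)^(-1/2) ∫ exp(-ikt) η̃(k) dk / (-ik + λ)^α(t)`. -/
def spectralMOU (α : ℝ → ℝ) (lam : ℝ) (η : L2 ℝ → Ω → ℝ) (t : ℝ) (ω : Ω) : ℂ :=
  spectralIntegral η (spectralKernel α lam t) ω

/-! ### The two covariance formulas -/

/-- `α₊(s,t) = (α(t) + α(s)) / 2`. -/
def alphaPlus (α : ℝ → ℝ) (s t : ℝ) : ℝ := (α t + α s) / 2

/-- The half difference `(α(t) - α(s)) / 2`, where `t` is the later time. -/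
def alphaMinus (α : ℝ → ℝ) (s t : ℝ) : ℝ := (α t - α s) / 2

/-- The form of the covariance in terms of Kummer's function, for `s < t`. -/
def kummerForm (α : ℝ → ℝ) (lam s t : ℝ) : ℝ :=
  Real.exp (-lam * (t - s)) * (t - s) ^ (2 * alphaPlus α s t - 1) / Real.Gamma (α t)
    * kummerU (α s) (2 * alphaPlus α s t) (2 * lam * (t - s))

/-- The form of the covariance in terms of the Whittaker function, for `s < t`. -/
def whittakerForm (α : ℝ → ℝ) (lam s t : ℝ) : ℝ :=
  (t - s) ^ (alphaPlus α s t - 1) / (Real.Gamma (α t) * (2 * lam) ^ alphaPlus α s t)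
    * whittakerW (alphaMinus α s t) (1 / 2 - alphaPlus α s t) (2 * lam * (t - s))

end

end MOU

namespace MOU

/-! ### Laplace integrals -/

/-! Everything is reduced to two deterministic facts: `kummerU` is well defined and computable, and
the spectral kernel is the inverse Fourier transform of the moving-average kernel.

Kummer's function. For a > 0 the Laplace integral ∫₀^∞ e^(-zt) t^(a-1) (1+t)^(b-a-1) dt, divided by
Γ(a), solves Kummer's equation with the required asymptotics; a contiguous relation lowers a and
reaches every real a (`exists_isKummerU`). Uniqueness (`IsKummerU.unique`) comes from the Wronskian
C e^z z^(-b) of two solutions: their quotient tends to 1, yet its derivative would grow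
exponentially unless C = 0. By uniqueness, z^(b-1) U(a,b,z) is U(a-b+1,2-b,z), which is the symmetry
of W in μ and links the two covariance forms. An affine substitution turns the inner product of two
moving-average kernels into the Laplace integral (`integral_movingAverageKernel_mul_of_lt`).

Fourier side. The Gamma integral with complex rate, ∫₀^∞ e^(-zx) x^(a-1) dx = Γ(a) z^(-a), gives the
Fourier transform of the moving-average kernel, and L² inversion gives
`unitaryFourier_spectralKernel`. Hence, driven by the same noise, X_t = Z_t almost surely for each t
(`spectralMOU_ae_eq`), so Z is real and Gaussian; Parseval yields its spectral covariance. For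
different noises, centred Gaussian families with equal covariances have equal finite-dimensional
laws. -/

theorem integrableOn_rpow_mul_one_add_rpow_mul_exp {a r : ℝ} (ha : 0 < a) (c : ℝ) (hr : 0 < r) :
    IntegrableOn (fun t : ℝ => Real.exp (-r * t) * (t ^ (a - 1) * (1 + t) ^ c)) (Set.Ioi 0) := by
  have h1 : ∀ s : ℝ, -1 < s →
      IntegrableOn (fun t : ℝ => t ^ s * Real.exp (-r * t)) (Set.Ioi 0) := by
    intro s hs
    simpa using integrableOn_rpow_mul_exp_neg_mul_rpow (p := 1) (s := s) (b := r) hs one_pos hr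
  have h2 := ((h1 (a - 1) (by linarith)).add
    (h1 (a - 1 + |c|) (by linarith [abs_nonneg c]))).const_mul (2 ^ |c|)
  refine Integrable.mono' h2 ?_ ?_
  · exact (by fun_prop : Measurable fun t : ℝ =>
      Real.exp (-r * t) * (t ^ (a - 1) * (1 + t) ^ c)).aestronglyMeasurable
  · filter_upwards [ae_restrict_mem measurableSet_Ioi] with t ht
    have ht : 0 < t := ht
    -- Whatever the sign of c, this bound leaves a sum of two Gamma integrands.
    have hb : (1 + t) ^ c ≤ 2 ^ |c| * (1 + t ^ |c|) := by
      calc (1 + t) ^ c ≤ (1 + t) ^ |c| :=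
            Real.rpow_le_rpow_of_exponent_le (by linarith) (le_abs_self c)
        _ ≤ (2 * max 1 t) ^ |c| := by
            apply Real.rpow_le_rpow (by linarith) _ (abs_nonneg c)
            linarith [le_max_left 1 t, le_max_right 1 t]
        _ = 2 ^ |c| * (max 1 t) ^ |c| := Real.mul_rpow (by norm_num) (by positivity)
        _ ≤ _ := by
            gcongr
            rcases max_cases 1 t with h | h <;> rw [h.1]
            · rw [Real.one_rpow]; linarith [Real.rpow_nonneg ht.le |c|]
            · linarith
    rw [Real.norm_of_nonneg (by positivity)]
    calc _ ≤ Real.exp (-r * t) * (t ^ (a - 1) * (2 ^ |c| * (1 + t ^ |c|))) := by gcongr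
      _ = _ := by simp only [Pi.add_apply]; rw [Real.rpow_add ht]; ring

theorem mul_exp_neg_mul_le {δ : ℝ} (hδ : 0 < δ) (t : ℝ) : t * Real.exp (-δ * t) ≤ 1 / δ := by
  have h := Real.add_one_le_exp (δ * t)
  rw [neg_mul, Real.exp_neg, le_div_iff₀ hδ, ← div_eq_mul_inv, div_mul_eq_mul_div,
    div_le_iff₀ (Real.exp_pos _)]
  linarith

/-- Differentiation under the integral sign. The variable is complex because the result serves both
Kummer's equation on the half-line and an analytic continuation in the right half-plane. -/
theorem hasDerivAt_laplace {f : ℝ → ℂ} (hf : ∀ r : ℝ, 0 < r →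
      IntegrableOn (fun t : ℝ => (Real.exp (-r * t) : ℂ) * f t) (Set.Ioi 0))
    {z : ℂ} (hz : 0 < z.re) :
    HasDerivAt (fun z : ℂ => ∫ t in Set.Ioi (0 : ℝ), Complex.exp (-z * t) * f t)
      (∫ t in Set.Ioi (0 : ℝ), -(Complex.exp (-z * t) * (t * f t))) z := by
  have hmeas : AEStronglyMeasurable f (volume.restrict (Set.Ioi (0 : ℝ))) := by
    have h := (hf 1 one_pos).aestronglyMeasurable
    have h2 := ((by fun_prop : Continuous fun t : ℝ =>
      (Real.exp t : ℂ)).aestronglyMeasurable (μ := volume.restrict (Set.Ioi (0 : ℝ)))).mul h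
    refine h2.congr (Eventually.of_forall fun t => ?_)
    simp only [Pi.mul_apply]
    rw [← mul_assoc, ← Complex.ofReal_mul, ← Real.exp_add]
    simp
  have hexp : ∀ w : ℂ, AEStronglyMeasurable (fun t : ℝ => Complex.exp (-w * t))
      (volume.restrict (Set.Ioi (0 : ℝ))) := fun w =>
    (by fun_prop : Continuous fun t : ℝ => Complex.exp (-w * t)).aestronglyMeasurable
  have hnorm : ∀ (w : ℂ) (t : ℝ), ‖Complex.exp (-w * t)‖ = Real.exp (-w.re * t) := by
    intro w t
    rw [Complex.norm_exp]; simp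
  -- On the ball of radius 2δ the real part stays at least 2δ. One factor e^(-δt) absorbs the t
  -- produced by differentiation, the other keeps the integrand integrable.
  set δ := z.re / 4 with hδdef
  have hδ : 0 < δ := by positivity
  refine (hasDerivAt_integral_of_dominated_loc_of_deriv_le (𝕜 := ℂ) (E := ℂ)
    (F := fun (z : ℂ) (t : ℝ) => Complex.exp (-z * t) * f t)
    (F' := fun (z : ℂ) (t : ℝ) => -(Complex.exp (-z * t) * (t * f t)))
    (s := Metric.ball z (2 * δ)) (bound := fun t : ℝ => 1 / δ *
      ‖(Real.exp (-δ * t) : ℂ) * f t‖)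
    (Metric.ball_mem_nhds z (by positivity)) ?_ ?_ ?_ ?_ ?_ ?_).2
  · exact Eventually.of_forall fun w => (hexp w).mul hmeas
  · refine (hf z.re hz).congr' ((hexp z).mul hmeas) (Eventually.of_forall fun t => ?_)
    simp only [norm_mul]
    rw [hnorm, Complex.norm_real, Real.norm_of_nonneg (Real.exp_pos _).le]
  · exact ((hexp z).mul ((by fun_prop : Continuous fun t : ℝ =>
      (t : ℂ)).aestronglyMeasurable.mul hmeas)).neg
  · filter_upwards [ae_restrict_mem measurableSet_Ioi] with t ht w hw
    have ht : 0 < t := ht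
    have hre : 2 * δ ≤ w.re := by
      have h1 : |(w - z).re| ≤ ‖w - z‖ := Complex.abs_re_le_norm _
      have h2 : ‖w - z‖ < 2 * δ := by simpa [dist_eq_norm] using hw
      have h3 := (abs_lt.1 (h1.trans_lt h2)).1
      rw [Complex.sub_re] at h3
      linarith
    rw [norm_neg, norm_mul, norm_mul, norm_mul, hnorm, Complex.norm_real, Complex.norm_real,
      Real.norm_of_nonneg ht.le, Real.norm_of_nonneg (Real.exp_pos _).le]
    have h4 : Real.exp (-w.re * t) ≤ Real.exp (-δ * t) * Real.exp (-δ * t) := by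
      rw [← Real.exp_add]
      apply Real.exp_le_exp.2
      nlinarith
    calc Real.exp (-w.re * t) * (t * ‖f t‖)
        ≤ Real.exp (-δ * t) * Real.exp (-δ * t) * (t * ‖f t‖) := by gcongr
      _ = (t * Real.exp (-δ * t)) * (Real.exp (-δ * t) * ‖f t‖) := by ring
      _ ≤ 1 / δ * (Real.exp (-δ * t) * ‖f t‖) := by
          gcongr; exact mul_exp_neg_mul_le hδ t
  · exact (hf δ hδ).norm.const_mul _
  · refine Eventually.of_forall fun t w _ => ?_
    have h := (((hasDerivAt_id w).neg.mul_const (t : ℂ)).cexp).mul_const (f t)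
    convert! h using 1
    simp only [Pi.neg_apply, id]
    ring

/-- `∫₀^∞ exp (-z t) t ^ (a - 1) (1 + t) ^ c dt`, which is `Γ(a) U(a, a + c + 1, z)`. -/
noncomputable def kummerIntegral (a c z : ℝ) : ℝ :=
  ∫ t in Set.Ioi (0 : ℝ), Real.exp (-z * t) * (t ^ (a - 1) * (1 + t) ^ c)

theorem hasDerivAt_kummerIntegral {a z : ℝ} (ha : 0 < a) (c : ℝ) (hz : 0 < z) :
    HasDerivAt (kummerIntegral a c) (-kummerIntegral (a + 1) c z) z := by
  have h := (hasDerivAt_laplace (f := fun t : ℝ => ((t ^ (a - 1) * (1 + t) ^ c : ℝ) : ℂ))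
    (fun r hr => by
      have := (integrableOn_rpow_mul_one_add_rpow_mul_exp ha c hr).ofReal (𝕜 := ℂ)
      simpa [IntegrableOn] using this) (z := z) (by simpa using hz)).real_of_complex
  convert! h using 1
  · funext x
    rw [kummerIntegral]
    simp_rw [← Complex.ofReal_neg, ← Complex.ofReal_mul, ← Complex.ofReal_exp,
      ← Complex.ofReal_mul]
    rw [integral_complex_ofReal, Complex.ofReal_re]
  · rw [kummerIntegral]
    simp_rw [← Complex.ofReal_neg, ← Complex.ofReal_mul, ← Complex.ofReal_exp,
      ← Complex.ofReal_mul, ← Complex.ofReal_neg]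
    rw [integral_complex_ofReal, Complex.ofReal_re, ← integral_neg]
    refine setIntegral_congr_fun measurableSet_Ioi fun t ht => ?_
    have ht : 0 < t := ht
    rw [show a + 1 - 1 = (a - 1) + 1 by ring, Real.rpow_add_one ht.ne']
    ring

/-- The combined integrand is the derivative of -e^(-zt) t^a (1+t)^(c+1), which vanishes at 0 and at
∞. Since differentiation in z sends a to a+1 with a sign, this is Kummer's equation with b = a+c+1.
-/
theorem kummerIntegral_ode {a z : ℝ} (ha : 0 < a) (c : ℝ) (hz : 0 < z) :
    z * kummerIntegral (a + 1 + 1) c z - (a + c + 1 - z) * kummerIntegral (a + 1) c z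
      - a * kummerIntegral a c z = 0 := by
  have i0 := integrableOn_rpow_mul_one_add_rpow_mul_exp ha c hz
  have i1 := integrableOn_rpow_mul_one_add_rpow_mul_exp (by linarith : 0 < a + 1) c hz
  have i2 := integrableOn_rpow_mul_one_add_rpow_mul_exp (by linarith : 0 < a + 1 + 1) c hz
  have key := integral_Ioi_of_hasDerivAt_of_tendsto (a := (0 : ℝ)) (m := 0)
    (f := fun t : ℝ => -(Real.exp (-z * t) * (t ^ a * (1 + t) ^ (c + 1))))
    (f' := fun t : ℝ => z * (Real.exp (-z * t) * (t ^ (a + 1 + 1 - 1) * (1 + t) ^ c))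
      - (a + c + 1 - z) * (Real.exp (-z * t) * (t ^ (a + 1 - 1) * (1 + t) ^ c))
      - a * (Real.exp (-z * t) * (t ^ (a - 1) * (1 + t) ^ c))) ?_ ?_
      (((i2.const_mul z).sub (i1.const_mul _)).sub (i0.const_mul a)) ?_
  · rw [integral_sub (by exact (i2.const_mul z).sub (i1.const_mul (a + c + 1 - z)))
      (i0.const_mul a), integral_sub (i2.const_mul z) (i1.const_mul _),
      integral_const_mul, integral_const_mul,
      integral_const_mul] at key
    simp only [kummerIntegral]
    rw [key]
    simp [Real.zero_rpow ha.ne']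
  · apply ContinuousAt.continuousWithinAt
    have h1 : ContinuousAt (fun t : ℝ => t ^ a) 0 :=
      continuousAt_id.rpow_const (Or.inr ha.le)
    have h2 : ContinuousAt (fun t : ℝ => (1 + t) ^ (c + 1)) 0 :=
      (by fun_prop : ContinuousAt (fun t : ℝ => 1 + t) 0).rpow_const (Or.inl (by norm_num))
    have h3 : ContinuousAt (fun t : ℝ => Real.exp (-z * t)) 0 := by fun_prop
    exact (h3.mul (h1.mul h2)).neg
  · intro t ht
    have ht : 0 < t := ht
    have h1 : HasDerivAt (fun t : ℝ => t ^ a) (a * t ^ (a - 1)) t :=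
      Real.hasDerivAt_rpow_const (Or.inl ht.ne')
    have h2 : HasDerivAt (fun t : ℝ => (1 + t) ^ (c + 1)) ((c + 1) * (1 + t) ^ c) t := by
      have := ((hasDerivAt_id t).const_add 1).rpow_const (p := c + 1)
        (Or.inl (by simp only [id]; linarith))
      convert! this using 1
      simp only [id, add_sub_cancel_right]; ring
    have h3 : HasDerivAt (fun t : ℝ => Real.exp (-z * t)) (Real.exp (-z * t) * -z) t := by
      simpa using ((hasDerivAt_id t).const_mul (-z)).exp
    have h := (h3.mul (h1.mul h2)).neg
    convert! h using 1
    rw [show a + 1 + 1 - 1 = (a - 1) + 1 + 1 by ring, show a + 1 - 1 = (a - 1) + 1 by ring,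
      show t ^ a = t ^ ((a - 1) + 1) by ring_nf, Real.rpow_add_one ht.ne',
      Real.rpow_add_one ht.ne', Real.rpow_add_one (by linarith : 1 + t ≠ 0)]
    simp only [Pi.mul_apply]
    rw [show t ^ a = t ^ ((a - 1) + 1) by ring_nf, Real.rpow_add_one ht.ne',
      Real.rpow_add_one (by linarith : 1 + t ≠ 0)]
    ring
  · have h1 : Tendsto (fun t : ℝ => (1 + t) ^ (|a| + |c + 1|) * Real.exp (-z * (1 + t)))
        atTop (𝓝 0) :=
      (tendsto_rpow_mul_exp_neg_mul_atTop_nhds_zero (|a| + |c + 1|) z hz).comp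
        (tendsto_atTop_add_const_left _ 1 tendsto_id)
    have h2 := h1.const_mul (Real.exp z)
    rw [mul_zero] at h2
    rw [← neg_zero]
    refine (squeeze_zero' ?_ ?_ h2).neg
    · filter_upwards [eventually_gt_atTop 0] with t ht
      positivity
    · filter_upwards [eventually_gt_atTop 0] with t ht
      have e1 : t ^ a ≤ (1 + t) ^ |a| := by
        rw [abs_of_pos ha]
        exact Real.rpow_le_rpow ht.le (by linarith) ha.le
      have e2 : (1 + t) ^ (c + 1) ≤ (1 + t) ^ |c + 1| :=
        Real.rpow_le_rpow_of_exponent_le (by linarith) (le_abs_self _)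
      calc Real.exp (-z * t) * (t ^ a * (1 + t) ^ (c + 1))
          ≤ Real.exp (-z * t) * ((1 + t) ^ |a| * (1 + t) ^ |c + 1|) := by gcongr
        _ = _ := by
          rw [Real.rpow_add (by linarith),
            show Real.exp (-z * t) = Real.exp z * Real.exp (-z * (1 + t)) by
              rw [← Real.exp_add]; ring_nf]
          ring

theorem rpow_mul_kummerIntegral (a c : ℝ) {z : ℝ} (hz : 0 < z) :
    z ^ a * kummerIntegral a c z
      = ∫ s in Set.Ioi (0 : ℝ), Real.exp (-s) * s ^ (a - 1) * (1 + s / z) ^ c := by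
  have h := integral_comp_mul_left_Ioi
    (fun s : ℝ => Real.exp (-s) * s ^ (a - 1) * (1 + s / z) ^ c) 0 hz
  rw [mul_zero, smul_eq_mul, ← div_eq_inv_mul, eq_div_iff hz.ne'] at h
  rw [← h, kummerIntegral, ← integral_const_mul, ← integral_mul_const]
  refine setIntegral_congr_fun measurableSet_Ioi fun t ht => ?_
  have ht : 0 < t := ht
  rw [Real.mul_rpow hz.le ht.le, mul_div_cancel_left₀ _ hz.ne',
    show z ^ a = z ^ ((a - 1) + 1) by ring_nf, Real.rpow_add_one hz.ne', neg_mul]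
  ring

/-- After the substitution s = zt the factor (1+s/z)^c tends to 1; for z ≥ 1 it is dominated by
(1+s)^|c|. -/
theorem tendsto_rpow_mul_kummerIntegral {a : ℝ} (ha : 0 < a) (c : ℝ) :
    Tendsto (fun z : ℝ => z ^ a * kummerIntegral a c z) atTop (𝓝 (Real.Gamma a)) := by
  have key : Tendsto (fun z : ℝ => ∫ s in Set.Ioi (0 : ℝ),
      Real.exp (-s) * s ^ (a - 1) * (1 + s / z) ^ c) atTop
      (𝓝 (∫ s in Set.Ioi (0 : ℝ), Real.exp (-s) * s ^ (a - 1))) := by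
    refine tendsto_integral_filter_of_dominated_convergence
      (fun s : ℝ => Real.exp (-1 * s) * (s ^ (a - 1) * (1 + s) ^ |c|)) ?_ ?_
      (integrableOn_rpow_mul_one_add_rpow_mul_exp ha |c| one_pos) ?_
    · exact Eventually.of_forall fun z => (by fun_prop : Measurable fun s : ℝ =>
        Real.exp (-s) * s ^ (a - 1) * (1 + s / z) ^ c).aestronglyMeasurable
    · filter_upwards [eventually_ge_atTop 1] with z hz
      filter_upwards [ae_restrict_mem measurableSet_Ioi] with s hs
      have hs : 0 < s := hs
      have hz0 : 0 < z := by linarith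
      rw [Real.norm_of_nonneg (by positivity), neg_one_mul, mul_assoc]
      have hsz : s / z ≤ s := div_le_self hs.le hz
      have h0 : 0 < s / z := by positivity
      gcongr
      calc (1 + s / z) ^ c ≤ (1 + s / z) ^ |c| :=
            Real.rpow_le_rpow_of_exponent_le (by linarith) (le_abs_self c)
        _ ≤ _ := Real.rpow_le_rpow (by linarith) (by linarith) (abs_nonneg c)
    · filter_upwards [ae_restrict_mem measurableSet_Ioi] with s hs
      have h1 : Tendsto (fun z : ℝ => 1 + s / z) atTop (𝓝 (1 + 0)) :=
        (tendsto_const_nhds.div_atTop tendsto_id).const_add 1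
      have h2 := (h1.rpow_const (p := c) (Or.inl (by norm_num))).const_mul
        (Real.exp (-s) * s ^ (a - 1))
      simpa using h2
  rw [Real.Gamma_eq_integral ha]
  refine key.congr' ?_
  filter_upwards [eventually_gt_atTop 0] with z hz
  rw [rpow_mul_kummerIntegral a c hz]

/-! ### Kummer's function: existence, uniqueness, Kummer's transformation -/

theorem IsKummerU.of_hasDerivAt {a b : ℝ} {w w' w'' : ℝ → ℝ}
    (h1 : ∀ z, 0 < z → HasDerivAt w (w' z) z) (h2 : ∀ z, 0 < z → HasDerivAt w' (w'' z) z)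
    (ode : ∀ z, 0 < z → z * w'' z + (b - z) * w' z - a * w z = 0)
    (asymptotic : Tendsto (fun z : ℝ => z ^ a * w z) atTop (𝓝 1)) : IsKummerU a b w := by
  have e1 : ∀ z, 0 < z → deriv w =ᶠ[𝓝 z] w' := fun z hz => by
    filter_upwards [lt_mem_nhds hz] with y hy using (h1 y hy).deriv
  have h2' : ∀ z, 0 < z → HasDerivAt (deriv w) (w'' z) z := fun z hz =>
    (h2 z hz).congr_of_eventuallyEq (e1 z hz)
  refine ⟨fun z hz => (h1 z hz).differentiableAt, fun z hz => (h2' z hz).differentiableAt,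
    fun z hz => ?_, asymptotic⟩
  rw [(h2' z hz).deriv, (h1 z hz).deriv]
  exact ode z hz

/-- Existence for `a > 0` from the integral representation. -/
theorem isKummerU_kummerIntegral {a : ℝ} (ha : 0 < a) (b : ℝ) :
    IsKummerU a b (fun z => (Real.Gamma a)⁻¹ * kummerIntegral a (b - a - 1) z) := by
  have hΓ := (Real.Gamma_pos_of_pos ha).ne'
  refine IsKummerU.of_hasDerivAt
    (w' := fun z => (Real.Gamma a)⁻¹ * -kummerIntegral (a + 1) (b - a - 1) z)
    (w'' := fun z => (Real.Gamma a)⁻¹ * - -kummerIntegral (a + 1 + 1) (b - a - 1) z)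
    (fun z hz => (hasDerivAt_kummerIntegral ha _ hz).const_mul _)
    (fun z hz => (hasDerivAt_kummerIntegral (by linarith) _ hz).neg.const_mul _)
    (fun z hz => ?_) ?_
  · have h := kummerIntegral_ode ha (b - a - 1) hz
    linear_combination (Real.Gamma a)⁻¹ * h
  · have h := (tendsto_rpow_mul_kummerIntegral ha (b - a - 1)).const_mul (Real.Gamma a)⁻¹
    rw [inv_mul_cancel₀ hΓ] at h
    refine h.congr fun z => ?_
    ring

/-- The derivative decays one power faster than the function. The asymptotics of w alone do not give
this, and the contiguous relation needs it. -/
theorem tendsto_rpow_mul_deriv_kummerIntegral {a : ℝ} (ha : 0 < a) (b : ℝ) :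
    Tendsto (fun z : ℝ => z ^ a *
      deriv (fun z => (Real.Gamma a)⁻¹ * kummerIntegral a (b - a - 1) z) z) atTop (𝓝 0) := by
  have h := ((tendsto_rpow_mul_kummerIntegral (by linarith : 0 < a + 1) (b - a - 1)).mul
    tendsto_inv_atTop_zero).const_mul (-(Real.Gamma a)⁻¹)
  rw [mul_zero, mul_zero] at h
  refine h.congr' ?_
  filter_upwards [eventually_gt_atTop 0] with z hz
  rw [((hasDerivAt_kummerIntegral ha (b - a - 1) hz).const_mul _).deriv,
    Real.rpow_add_one hz.ne']
  field_simp

theorem IsKummerU.hasDerivAt {a b : ℝ} {w : ℝ → ℝ} (h : IsKummerU a b w) {z : ℝ} (hz : 0 < z) :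
    HasDerivAt w (deriv w z) z :=
  (h.differentiableAt z hz).hasDerivAt

theorem IsKummerU.hasDerivAt_deriv {a b : ℝ} {w : ℝ → ℝ} (h : IsKummerU a b w) {z : ℝ}
    (hz : 0 < z) : HasDerivAt (deriv w) (deriv (deriv w) z) z :=
  (h.differentiableAt_deriv z hz).hasDerivAt

/-- The contiguous relation `U(a, b) = (a + 1 - b + z) U(a + 1, b) - z U'(a + 1, b)`. -/
theorem IsKummerU.contiguous {a b : ℝ} {w : ℝ → ℝ} (h : IsKummerU (a + 1) b w)
    (h0 : Tendsto (fun z : ℝ => z ^ (a + 1) * deriv w z) atTop (𝓝 0)) :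
    IsKummerU a b (fun z => (a + 1 - b + z) * w z - z * deriv w z) ∧
      Tendsto (fun z : ℝ => z ^ a * deriv (fun z => (a + 1 - b + z) * w z - z * deriv w z) z)
        atTop (𝓝 0) := by
  -- Kummer's equation eliminates w'', so the new function can be differentiated a second time.
  have d1 : ∀ z, 0 < z → HasDerivAt (fun z => (a + 1 - b + z) * w z - z * deriv w z)
      (a * (deriv w z - w z)) z := fun z hz => by
    have := (((hasDerivAt_id z).const_add (a + 1 - b)).mul (h.hasDerivAt hz)).sub
      ((hasDerivAt_id z).mul (h.hasDerivAt_deriv hz))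
    convert! this using 1
    simp only [id]
    linear_combination h.ode z hz
  have hw : ∀ z : ℝ, 0 < z → z ^ (a + 1) = z ^ a * z := fun z hz => Real.rpow_add_one hz.ne' a
  refine ⟨IsKummerU.of_hasDerivAt d1
    (fun z hz => ((h.hasDerivAt_deriv hz).sub (h.hasDerivAt hz)).const_mul a)
    (fun z hz => by linear_combination a * h.ode z hz) ?_, ?_⟩
  · have h1 := ((tendsto_inv_atTop_zero (𝕜 := ℝ)).const_mul (a + 1 - b)).add_const 1
    have h2 := (h1.mul h.asymptotic).sub h0
    simp only [mul_zero, zero_add, mul_one, sub_zero] at h2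
    refine h2.congr' ?_
    filter_upwards [eventually_gt_atTop 0] with z hz
    rw [hw z hz]
    field_simp
  · have h1 := ((tendsto_inv_atTop_zero (𝕜 := ℝ)).mul (h0.sub h.asymptotic)).const_mul a
    simp only [zero_mul, mul_zero] at h1
    refine h1.congr' ?_
    filter_upwards [eventually_gt_atTop 0] with z hz
    rw [(d1 z hz).deriv, hw z hz]
    field_simp

/-- Induction on n for a > -n: the integral covers a > 0, and each contiguous step lowers a by one.
The decay of the derivative is carried along as part of the induction hypothesis. -/
theorem exists_isKummerU (a b : ℝ) : ∃ w, IsKummerU a b w := by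
  have key : ∀ (n : ℕ) (a : ℝ), -(n : ℝ) < a → ∃ w, IsKummerU a b w ∧
      Tendsto (fun z : ℝ => z ^ a * deriv w z) atTop (𝓝 0) := by
    intro n
    induction n with
    | zero =>
      intro a ha
      have ha : 0 < a := by simpa using ha
      exact ⟨_, isKummerU_kummerIntegral ha b, tendsto_rpow_mul_deriv_kummerIntegral ha b⟩
    | succ n ih =>
      intro a ha
      obtain ⟨w, hw, hw0⟩ := ih (a + 1) (by push_cast at ha; linarith)
      exact ⟨_, hw.contiguous hw0⟩
  obtain ⟨n, hn⟩ := exists_nat_gt (-a)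
  obtain ⟨w, hw, _⟩ := key n a (by linarith)
  exact ⟨w, hw⟩

/-- Two solutions of Kummer's equation with the same Cauchy data at a point are equal. -/
theorem IsKummerU.eq_of_cauchyData {a b : ℝ} {w v : ℝ → ℝ} (hw : IsKummerU a b w)
    (hv : IsKummerU a b v) {z₀ : ℝ} (hz₀ : 0 < z₀) (h0 : w z₀ = v z₀)
    (h1 : deriv w z₀ = deriv v z₀) {z : ℝ} (hz : 0 < z) : w z = v z := by
  -- The interval (δ, M) contains both points and stays away from 0, so the first-order system for
  -- (w, w') has bounded coefficients and is Lipschitz there.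
  set δ := min z z₀ / 2 with hδ
  set M := max z z₀ + 1 with hM
  have hδ0 : 0 < δ := by positivity
  have hmin : δ < min z z₀ := half_lt_self (by positivity)
  have hmax : max z z₀ < M := lt_add_one _
  have hM0 : 0 < M := by positivity
  have hderiv : ∀ u : ℝ → ℝ, IsKummerU a b u → ∀ t ∈ Set.Ioo δ M,
      HasDerivAt (fun t => (u t, deriv u t))
        (deriv u t, ((t - b) * deriv u t + a * u t) / t) t := by
    intro u hu t ht
    have ht0 : 0 < t := hδ0.trans ht.1
    have h := (hu.hasDerivAt ht0).prodMk (hu.hasDerivAt_deriv ht0)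
    convert! h using 2
    rw [div_eq_iff ht0.ne']
    linear_combination -hu.ode t ht0
  obtain ⟨K, hK⟩ : ∃ K : NNReal, (K : ℝ) = (M + |b| + |a|) / δ :=
    ⟨Real.toNNReal _, Real.coe_toNNReal _ (by positivity)⟩
  have hlip : ∀ t ∈ Set.Ioo δ M, LipschitzOnWith (max 1 K)
      (fun p : ℝ × ℝ => (p.2, ((t - b) * p.2 + a * p.1) / t)) Set.univ := by
    intro t ht
    have ht0 : 0 < t := hδ0.trans ht.1
    apply LipschitzWith.lipschitzOnWith
    apply LipschitzWith.prodMk LipschitzWith.prod_snd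
    apply LipschitzWith.of_dist_le_mul
    intro p q
    rw [Real.dist_eq, hK]
    have e1 : |p.1 - q.1| ≤ dist p q := by
      rw [← Real.dist_eq]; exact le_max_left _ _
    have e2 : |p.2 - q.2| ≤ dist p q := by
      rw [← Real.dist_eq]; exact le_max_right _ _
    rw [← sub_div, abs_div, abs_of_pos ht0]
    have e3 : |(t - b) * p.2 + a * p.1 - ((t - b) * q.2 + a * q.1)|
        ≤ (M + |b| + |a|) * dist p q := by
      calc _ = |(t - b) * (p.2 - q.2) + a * (p.1 - q.1)| := by congr 1; ring
        _ ≤ |t - b| * |p.2 - q.2| + |a| * |p.1 - q.1| := by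
          rw [← abs_mul, ← abs_mul]; exact abs_add_le _ _
        _ ≤ (M + |b|) * dist p q + |a| * dist p q := by
          gcongr
          calc |t - b| ≤ |t| + |b| := abs_sub _ _
            _ ≤ M + |b| := by rw [abs_of_pos ht0]; linarith [ht.2]
        _ = _ := by ring
    rw [div_mul_eq_mul_div]
    have hnn : 0 ≤ (M + |b| + |a|) * dist p q := by positivity
    exact div_le_div₀ hnn e3 hδ0 ht.1.le
  have h := ODE_solution_unique_of_mem_Ioo
    (v := fun t (p : ℝ × ℝ) => (p.2, ((t - b) * p.2 + a * p.1) / t)) (s := fun _ => Set.univ)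
    (f := fun t => (w t, deriv w t)) (g := fun t => (v t, deriv v t)) (t₀ := z₀) hlip
    ⟨hmin.trans_le (min_le_right _ _), (le_max_right _ _).trans_lt hmax⟩
    (fun t ht => ⟨hderiv w hw t ht, Set.mem_univ _⟩)
    (fun t ht => ⟨hderiv v hv t ht, Set.mem_univ _⟩) (by simp [h0, h1])
  exact congrArg Prod.fst
    (h ⟨hmin.trans_le (min_le_left _ _), (le_max_left _ _).trans_lt hmax⟩)

/-- Abel's formula for the Wronskian. -/
theorem IsKummerU.exists_wronskian {a b : ℝ} {w v : ℝ → ℝ} (hw : IsKummerU a b w)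
    (hv : IsKummerU a b v) : ∃ C : ℝ, ∀ z, 0 < z →
      w z * deriv v z - deriv w z * v z = C * (Real.exp z * z ^ (-b)) := by
  -- Multiplied by the integrating factor e^(-z) z^b, the Wronskian is constant.
  have hd : ∀ z ∈ Set.Ioi (0 : ℝ), HasDerivAt (fun z : ℝ =>
      (w z * deriv v z - deriv w z * v z) * (Real.exp (-z) * z ^ b)) 0 z := by
    intro z hz
    have hz : 0 < z := hz
    have h1 := (((hw.hasDerivAt hz).mul (hv.hasDerivAt_deriv hz)).sub
      ((hw.hasDerivAt_deriv hz).mul (hv.hasDerivAt hz))).mul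
      (((hasDerivAt_neg z).exp).mul (Real.hasDerivAt_rpow_const (p := b) (Or.inl hz.ne')))
    convert! h1 using 1
    have e : z ^ b = z ^ (b - 1) * z := by rw [← Real.rpow_add_one hz.ne']; ring_nf
    simp only [Pi.sub_apply, Pi.mul_apply]
    rw [e]
    linear_combination Real.exp (-z) * z ^ (b - 1) *
      (v z * hw.ode z hz - w z * hv.ode z hz)
  refine ⟨(w 1 * deriv v 1 - deriv w 1 * v 1) * (Real.exp (-1) * 1 ^ b), fun z hz => ?_⟩
  have hc := (convex_Ioi (0 : ℝ)).is_const_of_fderivWithin_eq_zero (𝕜 := ℝ)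
    (fun z hz => (hd z hz).differentiableAt.differentiableWithinAt)
    (fun z hz => by
      rw [fderivWithin_of_isOpen isOpen_Ioi hz]
      simpa using (hd z hz).hasFDerivAt.fderiv)
    (show z ∈ Set.Ioi (0 : ℝ) from hz) (Set.mem_Ioi.2 (one_pos : (0 : ℝ) < 1))
  rw [← hc, Real.exp_neg, Real.rpow_neg hz.le]
  field_simp

/-- The quotient v/w tends to 1 and has derivative C e^z z^(-b) / w². Exponential growth forces C =
0, so v = w near infinity, and uniqueness for the Cauchy problem carries this to all z > 0. -/
theorem IsKummerU.unique {a b : ℝ} {w v : ℝ → ℝ} (hw : IsKummerU a b w)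
    (hv : IsKummerU a b v) {z : ℝ} (hz : 0 < z) : w z = v z := by
  obtain ⟨C, hC⟩ := hw.exists_wronskian hv
  have hpos : ∀ᶠ z : ℝ in atTop, 0 < z ∧ 0 < w z ∧ z ^ a * w z < 2 := by
    filter_upwards [hw.asymptotic.eventually (lt_mem_nhds one_pos),
      hw.asymptotic.eventually (gt_mem_nhds one_lt_two), eventually_gt_atTop 0] with z h1 h2 h3
    exact ⟨h3, pos_of_mul_pos_right h1 (by positivity), h2⟩
  have hq : Tendsto (fun z => v z / w z) atTop (𝓝 1) := by
    have := hv.asymptotic.div hw.asymptotic one_ne_zero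
    rw [div_one] at this
    refine this.congr' ?_
    filter_upwards [eventually_gt_atTop 0] with z hz
    have : z ^ a ≠ 0 := (Real.rpow_pos_of_pos hz a).ne'
    simp only [Pi.div_apply]
    rw [mul_div_mul_left _ _ this]
  have hqd : ∀ z, 0 < z → 0 < w z → HasDerivAt (fun z => v z / w z)
      (C * (Real.exp z * z ^ (-b)) / w z ^ 2) z := by
    intro z hz hwz
    have := (hv.hasDerivAt hz).div (hw.hasDerivAt hz) hwz.ne'
    convert! this using 2
    rw [← hC z hz]; ring
  have hC0 : C = 0 := by
    by_contra hne
    -- Eventually w² < 4 z^(-2a), so this is a lower bound for the absolute value of the derivative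
    -- of v/w; the mean value theorem on [S, S+1] contradicts it.
    have hgrow : Tendsto (fun z : ℝ => |C| / 4 * (Real.exp z / z ^ (b - 2 * a))) atTop atTop :=
      (tendsto_exp_div_rpow_atTop (b - 2 * a)).const_mul_atTop (by positivity)
    have hdiff : Tendsto (fun z : ℝ => v (z + 1) / w (z + 1) - v z / w z) atTop (𝓝 0) := by
      have := (hq.comp (tendsto_atTop_add_const_right _ 1 tendsto_id)).sub hq
      simpa using this
    obtain ⟨R, hR⟩ := eventually_atTop.1 (hpos.and (hgrow.eventually_ge_atTop 1))
    obtain ⟨S, hS⟩ := eventually_atTop.1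
      ((hdiff.eventually (Metric.ball_mem_nhds 0 one_pos)).and (eventually_ge_atTop R))
    have hRS : R ≤ S := (hS S le_rfl).2
    have hball := (hS S le_rfl).1
    obtain ⟨ξ, hξ, hξe⟩ := exists_hasDerivAt_eq_slope (fun z => v z / w z)
      (fun z => C * (Real.exp z * z ^ (-b)) / w z ^ 2) (lt_add_one S)
      (fun z hz => (hqd z (hR z (hRS.trans hz.1)).1.1
        (hR z (hRS.trans hz.1)).1.2.1).continuousAt.continuousWithinAt)
      (fun z hz => hqd z (hR z (hRS.trans hz.1.le)).1.1 (hR z (hRS.trans hz.1.le)).1.2.1)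
    obtain ⟨⟨hξ0, hwξ, hξ2⟩, hξ1⟩ := hR ξ (hRS.trans hξ.1.le)
    rw [dist_zero_right, Real.norm_eq_abs] at hball
    rw [add_sub_cancel_left, div_one] at hξe
    rw [← hξe, abs_div, abs_mul, abs_of_pos (by positivity : 0 < Real.exp ξ * ξ ^ (-b)),
      abs_of_pos (by positivity : 0 < w ξ ^ 2), div_lt_one (by positivity)] at hball
    have hsq : (ξ ^ a * w ξ) ^ 2 < 4 := by
      have : 0 < ξ ^ a * w ξ := by positivity
      nlinarith
    have e : Real.exp ξ / ξ ^ (b - 2 * a) = Real.exp ξ * ξ ^ (-b) * (ξ ^ a) ^ 2 := by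
      rw [div_eq_mul_inv, ← Real.rpow_neg hξ0.le, ← Real.rpow_natCast, ← Real.rpow_mul hξ0.le,
        mul_assoc, ← Real.rpow_add hξ0]
      congr 2; push_cast; ring
    rw [e] at hξ1
    have hsq0 : 0 < (ξ ^ a) ^ 2 := by positivity
    nlinarith
  obtain ⟨R, hR⟩ := eventually_atTop.1 hpos
  have hconst : ∀ x, R ≤ x → v x / w x = v R / w R := by
    intro x hx
    refine constant_of_has_deriv_right_zero (f := fun z => v z / w z) (a := R) (b := x)
      (fun z hz => (hqd z (hR z hz.1).1 (hR z hz.1).2.1).continuousAt.continuousWithinAt)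
      (fun z hz => ?_) x ⟨hx, le_rfl⟩
    have := hqd z (hR z hz.1).1 (hR z hz.1).2.1
    rw [hC0, zero_mul, zero_div] at this
    exact this.hasDerivWithinAt
  have hone : v R / w R = 1 := by
    refine tendsto_nhds_unique (tendsto_const_nhds.congr' ?_) hq
    filter_upwards [eventually_ge_atTop R] with x hx using (hconst x hx).symm
  have heq : ∀ x, R ≤ x → w x = v x := by
    intro x hx
    have := hconst x hx
    rw [hone, div_eq_one_iff_eq (hR x hx).2.1.ne'] at this
    exact this.symm
  have hev : w =ᶠ[𝓝 (R + 1)] v := by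
    filter_upwards [lt_mem_nhds (lt_add_one R)] with x hx using heq x hx.le
  exact hw.eq_of_cauchyData hv (hR (R + 1) (by linarith)).1 hev.eq_of_nhds hev.deriv_eq hz

theorem kummerU_eq {a b : ℝ} {w : ℝ → ℝ} (hw : IsKummerU a b w) {z : ℝ} (hz : 0 < z) :
    kummerU a b z = w z := by
  have h : ∃ w, IsKummerU a b w := ⟨w, hw⟩
  rw [kummerU, dif_pos h]
  exact h.choose_spec.unique hw hz

theorem isKummerU_kummerU (a b : ℝ) : IsKummerU a b (kummerU a b) := by
  have h := exists_isKummerU a b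
  have e : kummerU a b = h.choose := by
    funext z; rw [kummerU, dif_pos h]
  rw [e]
  exact h.choose_spec

theorem kummerU_eq_kummerIntegral {a : ℝ} (ha : 0 < a) (b : ℝ) {z : ℝ} (hz : 0 < z) :
    kummerU a b z = (Real.Gamma a)⁻¹ * kummerIntegral a (b - a - 1) z :=
  kummerU_eq (isKummerU_kummerIntegral ha b) hz

/-- Kummer's transformation of solutions. -/
theorem IsKummerU.rpow_mul {a b : ℝ} {w : ℝ → ℝ} (h : IsKummerU a b w) :
    IsKummerU (a - b + 1) (2 - b) (fun z => z ^ (b - 1) * w z) := by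
  have hp : ∀ (p z : ℝ), 0 < z → HasDerivAt (fun z : ℝ => z ^ p) (p * z ^ (p - 1)) z :=
    fun p z hz => Real.hasDerivAt_rpow_const (Or.inl hz.ne')
  refine IsKummerU.of_hasDerivAt
    (fun z hz => (hp (b - 1) z hz).mul (h.hasDerivAt hz))
    (fun z hz => (((hp (b - 1 - 1) z hz).const_mul (b - 1)).mul (h.hasDerivAt hz)).add
      ((hp (b - 1) z hz).mul (h.hasDerivAt_deriv hz)))
    (fun z hz => ?_) ?_
  · have e1 : z ^ (b - 1 - 1) = z ^ (b - 1 - 1 - 1) * z := by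
      rw [← Real.rpow_add_one hz.ne']; ring_nf
    have e2 : z ^ (b - 1) = z ^ (b - 1 - 1 - 1) * z * z := by
      rw [← Real.rpow_add_one hz.ne', ← Real.rpow_add_one hz.ne']; ring_nf
    rw [e2, e1]
    linear_combination z ^ (b - 1 - 1 - 1) * z * z * h.ode z hz
  -- Since z^(a-b+1) z^(b-1) = z^a, the limit is unchanged.
  · refine h.asymptotic.congr' ?_
    filter_upwards [eventually_gt_atTop 0] with z hz
    rw [← mul_assoc, ← Real.rpow_add hz]
    ring_nf

theorem kummerU_kummer_transformation (a b : ℝ) {z : ℝ} (hz : 0 < z) :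
    kummerU (a - b + 1) (2 - b) z = z ^ (b - 1) * kummerU a b z :=
  kummerU_eq (isKummerU_kummerU a b).rpow_mul hz

/-! ### Whittaker's function and the two covariance forms -/

theorem whittakerW_neg (κ μ : ℝ) {z : ℝ} (hz : 0 < z) :
    whittakerW κ μ z = whittakerW κ (-μ) z := by
  have h := kummerU_kummer_transformation (1 / 2 + μ - κ) (1 + 2 * μ) hz
  rw [show 1 / 2 + μ - κ - (1 + 2 * μ) + 1 = 1 / 2 + -μ - κ by ring,
    show 2 - (1 + 2 * μ) = 1 + 2 * -μ by ring] at h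
  rw [whittakerW, whittakerW, h, show 1 / 2 + μ = (1 / 2 + -μ) + (1 + 2 * μ - 1) by ring,
    Real.rpow_add hz]
  ring_nf

theorem kummerU_eq_whittakerW (α : ℝ → ℝ) {lam s t : ℝ} (hlam : 0 < lam) (hst : s < t) :
    kummerU (α s) (2 * alphaPlus α s t) (2 * lam * (t - s))
      = Real.exp (lam * (t - s)) * (2 * lam * (t - s)) ^ (-alphaPlus α s t)
        * whittakerW (alphaMinus α s t) (alphaPlus α s t - 1 / 2) (2 * lam * (t - s)) := by
  have hz : 0 < 2 * lam * (t - s) := by have := sub_pos.2 hst; positivity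
  rw [whittakerW, show 1 / 2 + (alphaPlus α s t - 1 / 2) = alphaPlus α s t by ring,
    show alphaPlus α s t - alphaMinus α s t = α s by rw [alphaPlus, alphaMinus]; ring,
    show 1 + 2 * (alphaPlus α s t - 1 / 2) = 2 * alphaPlus α s t by ring,
    show -(2 * lam * (t - s)) / 2 = -(lam * (t - s)) by ring, Real.exp_neg, Real.rpow_neg hz.le]
  have := (Real.rpow_pos_of_pos hz (alphaPlus α s t)).ne'
  field_simp

/-- The symmetry of W in μ replaces α₊ - 1/2 by 1/2 - α₊; the rest is bookkeeping of powers. -/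
theorem kummerForm_eq_whittakerForm (α : ℝ → ℝ) {lam s t : ℝ} (hlam : 0 < lam) (hst : s < t) :
    kummerForm α lam s t = whittakerForm α lam s t := by
  have hts := sub_pos.2 hst
  have hz : 0 < 2 * lam * (t - s) := by positivity
  rw [kummerForm, whittakerForm, kummerU_eq_whittakerW α hlam hst, whittakerW_neg _ _ hz,
    neg_sub, Real.rpow_neg hz.le, Real.mul_rpow (by positivity : 0 ≤ 2 * lam) hts.le, neg_mul,
    Real.exp_neg, show 2 * alphaPlus α s t - 1 = alphaPlus α s t + (alphaPlus α s t - 1) by ring,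
    Real.rpow_add hts]
  have h1 := (Real.rpow_pos_of_pos hts (alphaPlus α s t)).ne'
  have h2 := (Real.rpow_pos_of_pos (by positivity : 0 < 2 * lam) (alphaPlus α s t)).ne'
  field_simp

/-! ### The moving-average kernel and its covariance -/

/-- The kernel `x ↦ exp (-λ x) x ^ (a - 1) / Γ(a)`, `x > 0`. -/
noncomputable def gammaKernel (a lam : ℝ) : ℝ → ℝ :=
  (Set.Ioi 0).indicator fun x => 1 / Real.Gamma a * (Real.exp (-lam * x) * x ^ (a - 1))

theorem movingAverageKernel_eq (α : ℝ → ℝ) (lam t : ℝ) :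
    movingAverageKernel α lam t = fun u => gammaKernel (α t) lam (t - u) := by
  funext u
  simp only [movingAverageKernel, gammaKernel, Set.indicator, Set.mem_Iio, Set.mem_Ioi, sub_pos]

theorem measurable_gammaKernel (a lam : ℝ) : Measurable (gammaKernel a lam) :=
  (by fun_prop : Measurable fun x : ℝ =>
    1 / Real.Gamma a * (Real.exp (-lam * x) * x ^ (a - 1))).indicator measurableSet_Ioi

theorem integrableOn_exp_mul_rpow {a lam : ℝ} (ha : 0 < a) (hlam : 0 < lam) :
    IntegrableOn (fun x : ℝ => Real.exp (-lam * x) * x ^ (a - 1)) (Set.Ioi 0) := by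
  simpa using integrableOn_rpow_mul_one_add_rpow_mul_exp ha 0 hlam

theorem integrable_gammaKernel {a lam : ℝ} (ha : 0 < a) (hlam : 0 < lam) :
    Integrable (gammaKernel a lam) :=
  (integrable_indicator_iff measurableSet_Ioi).2 ((integrableOn_exp_mul_rpow ha hlam).const_mul _)

/-- The square behaves like x^(2a-2) at 0, integrable exactly because a > 1/2; the exponential
handles infinity. -/
theorem memLp_gammaKernel {a lam : ℝ} (ha : 1 / 2 < a) (hlam : 0 < lam) :
    MemLp (gammaKernel a lam) 2 volume := by
  rw [memLp_two_iff_integrable_sq (measurable_gammaKernel a lam).aestronglyMeasurable]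
  have h := (integrable_indicator_iff measurableSet_Ioi).2
    ((integrableOn_exp_mul_rpow (by linarith : 0 < 2 * a - 1)
      (by linarith : 0 < 2 * lam)).const_mul ((1 / Real.Gamma a) ^ 2))
  refine h.congr (Eventually.of_forall fun x => ?_)
  simp only [gammaKernel, Set.indicator, Set.mem_Ioi]
  split_ifs with hx
  · rw [mul_pow, mul_pow, ← Real.exp_nat_mul, ← Real.rpow_mul_natCast hx.le]
    push_cast
    ring_nf
  · simp

theorem memLp_movingAverageKernel {α : ℝ → ℝ} {lam : ℝ} (t : ℝ) (ht : 1 / 2 < α t)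
    (hlam : 0 < lam) : MemLp (movingAverageKernel α lam t) 2 volume := by
  rw [movingAverageKernel_eq]
  exact (memLp_gammaKernel ht hlam).comp_measurePreserving
    (Measure.measurePreserving_sub_left volume t)

theorem integrable_movingAverageKernel {α : ℝ → ℝ} {lam : ℝ} (t : ℝ) (ht : 0 < α t)
    (hlam : 0 < lam) : Integrable (movingAverageKernel α lam t) := by
  rw [movingAverageKernel_eq]
  exact (integrable_gammaKernel ht hlam).comp_sub_left t

theorem integral_movingAverageKernel_mul (α : ℝ → ℝ) (lam s t : ℝ) :
    ∫ u, movingAverageKernel α lam t u * movingAverageKernel α lam s u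
      = Real.exp (-lam * (t + s)) / (Real.Gamma (α t) * Real.Gamma (α s))
          * ∫ u in Set.Iio (min t s),
              (t - u) ^ (α t - 1) * (s - u) ^ (α s - 1) * Real.exp (2 * lam * u) := by
  rw [← integral_const_mul, ← integral_indicator measurableSet_Iio]
  congr 1
  funext u
  simp only [movingAverageKernel, Set.indicator, Set.mem_Iio, lt_min_iff]
  by_cases h1 : u < t <;> by_cases h2 : u < s <;> simp only [h1, h2, if_true, if_false, and_true,
    and_false, mul_zero, zero_mul, and_self]
  have e : Real.exp (-lam * (t - u)) * Real.exp (-lam * (s - u))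
      = Real.exp (-lam * (t + s)) * Real.exp (2 * lam * u) := by
    rw [← Real.exp_add, ← Real.exp_add]; ring_nf
  rw [one_div, one_div, div_eq_mul_inv, mul_inv]
  linear_combination (Real.Gamma (α t))⁻¹ * (Real.Gamma (α s))⁻¹ * (t - u) ^ (α t - 1)
    * (s - u) ^ (α s - 1) * e

theorem setIntegral_Iio_comp_sub_mul (f : ℝ → ℝ) (s : ℝ) {c : ℝ} (hc : 0 < c) :
    ∫ u in Set.Iio s, f u = c * ∫ x in Set.Ioi 0, f (s - c * x) := by
  have h1 : ∫ u in Set.Iio s, f u = ∫ y in Set.Ioi 0, f (s - y) := by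
    rw [← integral_indicator measurableSet_Iio, ← integral_indicator measurableSet_Ioi,
      ← integral_sub_left_eq_self _ volume s]
    congr 1
    funext y
    simp [Set.indicator]
  have h2 := integral_comp_mul_left_Ioi (fun y => f (s - y)) 0 hc
  rw [h1, h2, mul_zero, smul_eq_mul, mul_inv_cancel_left₀ hc.ne']

/-- Substituting u = s - (t-s)x turns t-u and s-u into (t-s)(1+x) and (t-s)x, which leaves the
Laplace integral at 2λ(t-s). The factor 1/Γ(α(s)) is absorbed by the normalization of U. -/
theorem integral_movingAverageKernel_mul_of_lt {α : ℝ → ℝ} {lam s t : ℝ} (hs : 0 < α s)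
    (hlam : 0 < lam) (hst : s < t) :
    ∫ u, movingAverageKernel α lam t u * movingAverageKernel α lam s u
      = kummerForm α lam s t := by
  have hts := sub_pos.2 hst
  have hz : 0 < 2 * lam * (t - s) := by positivity
  rw [integral_movingAverageKernel_mul, min_eq_right hst.le,
    setIntegral_Iio_comp_sub_mul _ s hts, kummerForm, kummerU_eq_kummerIntegral hs _ hz,
    kummerIntegral]
  have key : ∀ x ∈ Set.Ioi (0 : ℝ), (t - (s - (t - s) * x)) ^ (α t - 1)
      * (s - (s - (t - s) * x)) ^ (α s - 1) * Real.exp (2 * lam * (s - (t - s) * x))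
      = ((t - s) ^ (α t - 1) * (t - s) ^ (α s - 1) * Real.exp (2 * lam * s)) *
        (Real.exp (-(2 * lam * (t - s)) * x)
          * (x ^ (α s - 1) * (1 + x) ^ (2 * alphaPlus α s t - α s - 1))) := by
    intro x hx
    have hx : 0 < x := hx
    rw [show t - (s - (t - s) * x) = (t - s) * (1 + x) by ring,
      show s - (s - (t - s) * x) = (t - s) * x by ring, Real.mul_rpow hts.le (by linarith),
      Real.mul_rpow hts.le hx.le,
      show 2 * lam * (s - (t - s) * x) = 2 * lam * s + -(2 * lam * (t - s)) * x by ring,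
      Real.exp_add, show 2 * alphaPlus α s t - α s - 1 = α t - 1 by rw [alphaPlus]; ring]
    ring
  rw [setIntegral_congr_fun measurableSet_Ioi key, integral_const_mul]
  have e1 : Real.exp (-lam * (t + s)) * Real.exp (2 * lam * s) = Real.exp (-lam * (t - s)) := by
    rw [← Real.exp_add]; ring_nf
  have e2 : (t - s) * ((t - s) ^ (α t - 1) * (t - s) ^ (α s - 1))
      = (t - s) ^ (2 * alphaPlus α s t - 1) := by
    rw [← Real.rpow_add hts, mul_comm, ← Real.rpow_add_one hts.ne', alphaPlus]
    ring_nf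
  rw [← e1, ← e2]
  simp only [div_eq_mul_inv, mul_inv]
  ring

/-! ### The spectral kernel -/

theorem spectral_re (lam k : ℝ) : (-Complex.I * k + lam : ℂ).re = lam := by simp

theorem norm_spectralKernel (α : ℝ → ℝ) {lam : ℝ} (hlam : 0 < lam) (t k : ℝ) :
    ‖spectralKernel α lam t k‖ = 1 / √(2 * Real.pi) * (k ^ 2 + lam ^ 2) ^ (-(α t) / 2) := by
  have hne : (-Complex.I * k + lam : ℂ) ≠ 0 := fun h => by
    have := spectral_re lam k
    rw [h] at this
    simp only [Complex.zero_re] at this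
    exact hlam.ne this
  have h1 : ‖(-Complex.I * k + lam : ℂ)‖ = √(k ^ 2 + lam ^ 2) := by
    rw [Complex.norm_def, Complex.normSq_apply]; simp; ring_nf
  have h2 : ‖Complex.exp (-Complex.I * k * t)‖ = 1 := by
    rw [Complex.norm_exp]; simp
  rw [spectralKernel, norm_mul, norm_div, norm_div, h2, norm_one, Complex.norm_real,
    Real.norm_of_nonneg (Real.sqrt_nonneg _), Complex.norm_cpow_of_ne_zero hne, h1]
  simp only [Complex.ofReal_re, Complex.ofReal_im, mul_zero, Real.exp_zero, div_one]
  rw [Real.sqrt_eq_rpow (k ^ 2 + lam ^ 2), ← Real.rpow_mul (by positivity), one_div (_ ^ _),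
    ← Real.rpow_neg (by positivity)]
  ring_nf

theorem measurable_spectralKernel (α : ℝ → ℝ) (lam t : ℝ) :
    Measurable (spectralKernel α lam t) := by
  unfold spectralKernel
  fun_prop

theorem memLp_spectralKernel {α : ℝ → ℝ} {lam : ℝ} (t : ℝ) (ht : 1 / 2 < α t)
    (hlam : 0 < lam) : MemLp (spectralKernel α lam t) 2 volume := by
  rw [memLp_two_iff_integrable_sq_norm (measurable_spectralKernel α lam t).aestronglyMeasurable]
  -- The squared norm is a rescaled (1+x²)^(-α(t)), integrable since 2α(t) exceeds the dimension 1.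
  have h := (((integrable_rpow_neg_one_add_norm_sq (E := ℝ) (μ := volume) (r := 2 * α t)
    (by simpa using by linarith)).comp_div hlam.ne').const_mul
      ((1 / √(2 * Real.pi)) ^ 2 * (lam ^ 2) ^ (-(α t))))
  refine h.congr (Eventually.of_forall fun k => ?_)
  simp only
  rw [norm_spectralKernel α hlam, mul_pow, ← Real.rpow_mul_natCast (by positivity), mul_assoc,
    show -(2 * α t) / 2 = -α t by ring,
    ← Real.mul_rpow (by positivity) (by positivity)]
  congr 1
  rw [Real.norm_eq_abs, sq_abs]
  push_cast
  congr 1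
  · field_simp
    ring
  · ring

/-! ### Fourier transforms -/

/-- Both sides are holomorphic in the right half-plane and agree for real z, hence everywhere by the
identity theorem. -/
theorem integral_exp_neg_mul_mul_rpow {a : ℝ} (ha : 0 < a) {z : ℂ} (hz : 0 < z.re) :
    ∫ x in Set.Ioi (0 : ℝ), Complex.exp (-z * x) * ((x ^ (a - 1) : ℝ) : ℂ)
      = Real.Gamma a / z ^ (a : ℂ) := by
  have hopen : IsOpen {z : ℂ | 0 < z.re} := isOpen_lt continuous_const Complex.continuous_re
  have hconn : IsPreconnected {z : ℂ | 0 < z.re} :=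
    (convex_halfSpace_re_gt 0).isPreconnected
  have hI : ∀ z : ℂ, 0 < z.re → DifferentiableAt ℂ
      (fun z : ℂ => ∫ x in Set.Ioi (0 : ℝ), Complex.exp (-z * x) * ((x ^ (a - 1) : ℝ) : ℂ)) z := by
    intro z hz
    refine (hasDerivAt_laplace (fun r hr => ?_) hz).differentiableAt
    have := (integrableOn_exp_mul_rpow ha hr).ofReal (𝕜 := ℂ)
    simpa [IntegrableOn] using this
  have hG : ∀ z : ℂ, 0 < z.re →
      DifferentiableAt ℂ (fun z : ℂ => (Real.Gamma a : ℂ) / z ^ (a : ℂ)) z := by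
    intro z hz
    have hs : z ∈ Complex.slitPlane := Or.inl hz
    exact (differentiableAt_const _).div (differentiableAt_id.cpow_const hs)
      (by simp [Complex.cpow_eq_zero_iff, Complex.slitPlane_ne_zero hs])
  have hreal : ∀ r : ℝ, 0 < r →
      ∫ x in Set.Ioi (0 : ℝ), Complex.exp (-(r : ℂ) * x) * ((x ^ (a - 1) : ℝ) : ℂ)
        = Real.Gamma a / (r : ℂ) ^ (a : ℂ) := by
    intro r hr
    have h := Real.integral_rpow_mul_exp_neg_mul_Ioi ha hr
    rw [← Complex.ofReal_cpow hr.le, ← Complex.ofReal_div]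
    simp_rw [← Complex.ofReal_neg, ← Complex.ofReal_mul, ← Complex.ofReal_exp,
      ← Complex.ofReal_mul]
    rw [integral_complex_ofReal]
    congr 1
    rw [div_eq_inv_mul, ← Real.inv_rpow hr.le, ← one_div, ← h]
    congr 1
    funext x
    rw [neg_mul, mul_comm]
  have hA := DifferentiableOn.analyticOnNhd
    (fun z hz => (hI z hz).differentiableWithinAt) hopen
  have hB := DifferentiableOn.analyticOnNhd
    (fun z hz => (hG z hz).differentiableWithinAt) hopen
  refine hA.eqOn_of_preconnected_of_frequently_eq hB hconn (z₀ := 1)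
    (show (0 : ℝ) < (1 : ℂ).re from one_pos) ?_ hz
  have hmap : Tendsto (fun r : ℝ => (r : ℂ)) (𝓝[>] (1 : ℝ)) (𝓝[≠] (1 : ℂ)) := by
    refine tendsto_nhdsWithin_iff.2 ⟨?_, ?_⟩
    · exact (Complex.continuous_ofReal.tendsto' 1 1 (by simp)).mono_left nhdsWithin_le_nhds
    · filter_upwards [self_mem_nhdsWithin] with r hr
      have hr : (1 : ℝ) < r := hr
      simpa using hr.ne'
  refine hmap.frequently (Eventually.frequently ?_)
  filter_upwards [self_mem_nhdsWithin] with r hr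
  exact hreal r (one_pos.trans hr)

/-- With k = 2πξ and u = t - x, the shift produces the phase e^(-ikt), and what remains is the Gamma
integral with rate z = -ik + λ. -/
theorem fourier_movingAverageKernel {α : ℝ → ℝ} {lam : ℝ} (t : ℝ) (ht : 0 < α t)
    (hlam : 0 < lam) (ξ : ℝ) :
    𝓕 (fun u => (movingAverageKernel α lam t u : ℂ)) ξ
      = (√(2 * Real.pi) : ℂ) * spectralKernel α lam t (2 * Real.pi * ξ) := by
  have hΓ : (Real.Gamma (α t) : ℂ) ≠ 0 := by exact_mod_cast (Real.Gamma_pos_of_pos ht).ne'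
  have hsq : (√(2 * Real.pi) : ℂ) ≠ 0 := by
    exact_mod_cast (Real.sqrt_pos.2 Real.two_pi_pos).ne'
  set z : ℂ := -Complex.I * ((2 * Real.pi * ξ : ℝ) : ℂ) + lam with hzdef
  have hz : 0 < z.re := by rw [hzdef, spectral_re]; exact hlam
  rw [Real.fourier_real_eq_integral_exp_smul, movingAverageKernel_eq,
    ← integral_sub_left_eq_self _ volume t]
  have key : ∀ x : ℝ, Complex.exp (↑(-2 * Real.pi * (t - x) * ξ) * Complex.I) •
      ((gammaKernel (α t) lam (t - (t - x)) : ℝ) : ℂ)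
      = (Set.Ioi (0 : ℝ)).indicator (fun x : ℝ =>
        Complex.exp (-Complex.I * ((2 * Real.pi * ξ : ℝ) : ℂ) * t) * (1 / Real.Gamma (α t)) *
        (Complex.exp (-z * x) * ((x ^ (α t - 1) : ℝ) : ℂ))) x := by
    intro x
    simp only [gammaKernel, Set.indicator, Set.mem_Ioi, sub_sub_cancel]
    split_ifs with hx
    · push_cast
      rw [smul_eq_mul, show Complex.exp (-2 * Real.pi * (t - x) * ξ * Complex.I)
          * (1 / Real.Gamma (α t) * (Complex.exp (-lam * x) * ((x ^ (α t - 1) : ℝ) : ℂ)))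
        = (Complex.exp (-2 * Real.pi * (t - x) * ξ * Complex.I) * Complex.exp (-lam * x))
          * (1 / Real.Gamma (α t)) * ((x ^ (α t - 1) : ℝ) : ℂ) by ring, ← Complex.exp_add,
        show ∀ A B C D : ℂ, A * B * (C * D) = A * C * B * D by intros; ring, ← Complex.exp_add]
      congr 3
      rw [hzdef]; push_cast; ring
    · simp
  simp_rw [key]
  rw [integral_indicator measurableSet_Ioi, integral_const_mul,
    integral_exp_neg_mul_mul_rpow ht hz, spectralKernel]
  field_simp
  rw [hzdef, neg_mul]

theorem toL2_of_memLp {E : Type} [NormedAddCommGroup E] {f : ℝ → E} (hf : MemLp f 2 volume) :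
    toL2 f = hf.toLp f := dif_pos hf

theorem coeFn_toL2 {E : Type} [NormedAddCommGroup E] {f : ℝ → E} (hf : MemLp f 2 volume) :
    toL2 f =ᵐ[volume] f := by
  rw [toL2_of_memLp hf]; exact hf.coeFn_toLp

/-- The `L²` Fourier transform agrees with the Fourier integral on `L¹ ∩ L²`. -/
theorem fourier_toL2 {f : ℝ → ℂ} (h1 : Integrable f) (h2 : MemLp f 2 volume)
    (h3 : MemLp (𝓕 f) 2 volume) : 𝓕 (toL2 f) = toL2 (𝓕 f) := by
  -- L² embeds in the tempered distributions, so it suffices to test on Schwartz φ, where the claim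
  -- is ∫ (𝓕φ) f = ∫ φ (𝓕f) for integrable f.
  have hinj : Function.Injective (Lp.toTemperedDistributionCLM (E := ℝ) ℂ volume 2) :=
    LinearMap.ker_eq_bot.1 Lp.ker_toTemperedDistributionCLM_eq_bot
  apply hinj
  rw [Lp.toTemperedDistributionCLM_apply, Lp.toTemperedDistributionCLM_apply,
    ← Lp.fourier_toTemperedDistribution_eq]
  ext φ
  rw [TemperedDistribution.fourier_apply, Lp.toTemperedDistribution_apply,
    Lp.toTemperedDistribution_apply]
  have e1 : ∫ x, (𝓕 φ) x • toL2 f x = ∫ x, (𝓕 φ) x • f x :=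
    integral_congr_ae ((coeFn_toL2 h2).mono fun x hx => by simp only [hx])
  have e2 : ∫ x, φ x • toL2 (𝓕 f) x = ∫ x, φ x • (𝓕 f) x :=
    integral_congr_ae ((coeFn_toL2 h3).mono fun x hx => by simp only [hx])
  rw [e1, e2]
  have h := VectorFourier.integral_fourierIntegral_smul_eq_flip (L := innerₗ ℝ)
    (μ := volume) (ν := volume) (e := 𝐞) Real.continuous_fourierChar
    (by exact continuous_inner) φ.integrable h1
  simpa [SchwartzMap.fourier_coe, Real.fourier_eq, VectorFourier.fourierIntegral,
    real_inner_comm, flip_innerₗ] using h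

theorem memLp_ofReal_movingAverageKernel {α : ℝ → ℝ} {lam : ℝ} (t : ℝ) (ht : 1 / 2 < α t)
    (hlam : 0 < lam) : MemLp (fun u => (movingAverageKernel α lam t u : ℂ)) 2 volume :=
  (memLp_movingAverageKernel t ht hlam).ofReal

theorem memLp_fourier_movingAverageKernel {α : ℝ → ℝ} {lam : ℝ} (t : ℝ) (ht : 1 / 2 < α t)
    (hlam : 0 < lam) : MemLp (𝓕 fun u => (movingAverageKernel α lam t u : ℂ)) 2 volume := by
  have e : (𝓕 fun u => (movingAverageKernel α lam t u : ℂ))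
      = fun ξ => (√(2 * Real.pi) : ℂ) * spectralKernel α lam t (2 * Real.pi * ξ) :=
    funext fun ξ => by
      simpa using fourier_movingAverageKernel t (by linarith) hlam ξ
  have hm : Measurable fun ξ : ℝ => spectralKernel α lam t (2 * Real.pi * ξ) :=
    (measurable_spectralKernel α lam t).comp (measurable_const_mul _)
  rw [e]
  refine MemLp.const_mul ?_ _
  rw [memLp_two_iff_integrable_sq_norm hm.aestronglyMeasurable]
  exact ((memLp_two_iff_integrable_sq_norm
    (measurable_spectralKernel α lam t).aestronglyMeasurable).1
    (memLp_spectralKernel t ht hlam)).comp_mul_left' Real.two_pi_pos.ne'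

theorem fourier_toL2_movingAverageKernel {α : ℝ → ℝ} {lam : ℝ} (t : ℝ) (ht : 1 / 2 < α t)
    (hlam : 0 < lam) : 𝓕 (toL2 fun u => (movingAverageKernel α lam t u : ℂ))
      = toL2 (𝓕 fun u => (movingAverageKernel α lam t u : ℂ)) :=
  fourier_toL2 (integrable_movingAverageKernel t (by linarith) hlam).ofReal
    (memLp_ofReal_movingAverageKernel t ht hlam) (memLp_fourier_movingAverageKernel t ht hlam)

/-- The moving-average kernel is the Fourier transform of the spectral kernel. -/
theorem unitaryFourier_spectralKernel {α : ℝ → ℝ} {lam : ℝ} (t : ℝ) (ht : 1 / 2 < α t)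
    (hlam : 0 < lam) : unitaryFourier (spectralKernel α lam t)
      = toL2 fun u => (movingAverageKernel α lam t u : ℂ) := by
  have e : (fun ξ : ℝ => (√(2 * Real.pi) : ℂ) * spectralKernel α lam t (2 * Real.pi * ξ))
      = 𝓕 fun u => (movingAverageKernel α lam t u : ℂ) :=
    funext fun ξ => (fourier_movingAverageKernel t (by linarith) hlam ξ).symm
  -- Inversion is done in L²: the spectral kernel is not integrable when α(t) ≤ 1.
  rw [unitaryFourier, e, ← fourier_toL2_movingAverageKernel t ht hlam]
  exact fourierInv_fourier_eq _

/-! ### Inner products and Parseval's formula -/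

theorem inner_toL2_real {f g : ℝ → ℝ} (hf : MemLp f 2 volume) (hg : MemLp g 2 volume) :
    inner ℝ (toL2 f) (toL2 g) = ∫ u, f u * g u := by
  rw [L2.inner_def]
  refine integral_congr_ae ?_
  filter_upwards [coeFn_toL2 hf, coeFn_toL2 hg] with u h1 h2
  rw [h1, h2, real_inner_eq_re_inner]
  simp [mul_comm]

theorem inner_toL2_complex {f g : ℝ → ℂ} (hf : MemLp f 2 volume) (hg : MemLp g 2 volume) :
    inner ℂ (toL2 f) (toL2 g) = ∫ u, starRingEnd ℂ (f u) * g u := by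
  rw [L2.inner_def]
  refine integral_congr_ae ?_
  filter_upwards [coeFn_toL2 hf, coeFn_toL2 hg] with u h1 h2
  rw [h1, h2, RCLike.inner_apply, mul_comm]

theorem conj_spectralKernel_mul (α : ℝ → ℝ) {lam : ℝ} (hlam : 0 < lam) (s t k : ℝ) :
    starRingEnd ℂ (spectralKernel α lam s k) * spectralKernel α lam t k
      = 1 / (2 * Real.pi) * (Complex.exp (-Complex.I * k * (t - s))
            / ((-Complex.I * k + lam) ^ (α t : ℂ) * (Complex.I * k + lam) ^ (α s : ℂ))) := by
  -- The real part is λ > 0, so the base is off the branch cut and conjugation commutes with the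
  -- power.
  have harg : (Complex.I * k + lam : ℂ).arg ≠ Real.pi := by
    intro h
    rw [Complex.arg_eq_pi_iff] at h
    simp at h
    linarith
  have h1 : starRingEnd ℂ ((-Complex.I * k + lam : ℂ) ^ (α s : ℂ))
      = (Complex.I * k + lam : ℂ) ^ (α s : ℂ) := by
    have h := Complex.cpow_conj (Complex.I * k + lam) (α s : ℂ) harg
    simp only [map_add, map_mul, Complex.conj_I, Complex.conj_ofReal] at h
    exact h.symm
  have h2 : (√(2 * Real.pi) : ℂ) * (√(2 * Real.pi) : ℂ) = 2 * Real.pi := by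
    rw [← Complex.ofReal_mul, Real.mul_self_sqrt Real.two_pi_pos.le]; push_cast; rfl
  have h3 : Complex.exp (-Complex.I * k * (t - s))
      = Complex.exp (Complex.I * k * s) * Complex.exp (-Complex.I * k * t) := by
    rw [← Complex.exp_add]; ring_nf
  rw [spectralKernel, spectralKernel, map_mul, map_div₀, map_div₀, h1, ← Complex.exp_conj, h3,
    ← h2]
  simp only [map_mul, map_neg, map_one, Complex.conj_I, Complex.conj_ofReal, neg_neg]
  simp only [div_eq_mul_inv, mul_inv]
  ring

/-- Parseval's formula for the two kernels. -/
theorem integral_spectral_eq {α : ℝ → ℝ} {lam : ℝ} (s t : ℝ) (hs : 1 / 2 < α s)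
    (ht : 1 / 2 < α t) (hlam : 0 < lam) :
    1 / (2 * Real.pi) * ∫ k : ℝ, Complex.exp (-Complex.I * k * (t - s))
            / ((-Complex.I * k + lam) ^ (α t : ℂ) * (Complex.I * k + lam) ^ (α s : ℂ))
      = ((∫ u, movingAverageKernel α lam t u * movingAverageKernel α lam s u : ℝ) : ℂ) := by
  have h := Lp.inner_fourier_eq (toL2 fun u => (movingAverageKernel α lam s u : ℂ))
    (toL2 fun u => (movingAverageKernel α lam t u : ℂ))
  rw [fourier_toL2_movingAverageKernel s hs hlam, fourier_toL2_movingAverageKernel t ht hlam,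
    inner_toL2_complex (memLp_fourier_movingAverageKernel s hs hlam)
      (memLp_fourier_movingAverageKernel t ht hlam),
    inner_toL2_complex (memLp_ofReal_movingAverageKernel s hs hlam)
      (memLp_ofReal_movingAverageKernel t ht hlam)] at h
  have hR : ∫ u, starRingEnd ℂ (movingAverageKernel α lam s u : ℂ)
      * (movingAverageKernel α lam t u : ℂ)
      = ((∫ u, movingAverageKernel α lam t u * movingAverageKernel α lam s u : ℝ) : ℂ) := by
    rw [← integral_complex_ofReal]
    congr 1
    funext u
    rw [Complex.conj_ofReal, mul_comm, Complex.ofReal_mul]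
  rw [← hR, ← h, ← integral_const_mul]
  simp_rw [← conj_spectralKernel_mul α hlam s t]
  have h2 : (√(2 * Real.pi) : ℂ) * (√(2 * Real.pi) : ℂ) = ((2 * Real.pi : ℝ) : ℂ) := by
    rw [← Complex.ofReal_mul, Real.mul_self_sqrt Real.two_pi_pos.le]
  have hL : ∀ ξ : ℝ, starRingEnd ℂ ((𝓕 fun u => (movingAverageKernel α lam s u : ℂ)) ξ)
      * (𝓕 fun u => (movingAverageKernel α lam t u : ℂ)) ξ
      = ((2 * Real.pi : ℝ) : ℂ) * (starRingEnd ℂ (spectralKernel α lam s (2 * Real.pi * ξ))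
        * spectralKernel α lam t (2 * Real.pi * ξ)) := by
    intro ξ
    rw [fourier_movingAverageKernel s (by linarith) hlam,
      fourier_movingAverageKernel t (by linarith) hlam, map_mul, Complex.conj_ofReal, ← h2]
    ring
  simp_rw [hL]
  -- The Jacobian of k = 2πξ cancels the factor 2π.
  rw [integral_const_mul, Measure.integral_comp_mul_left
    (fun k => starRingEnd ℂ (spectralKernel α lam s k) * spectralKernel α lam t k),
    abs_of_pos (by positivity), Complex.real_smul, ← mul_assoc, ← Complex.ofReal_mul,
    mul_inv_cancel₀ Real.two_pi_pos.ne', Complex.ofReal_one, one_mul]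

/-! ### The two processes -/

section WhiteNoiseDriven

variable {Ω Ω' : Type*} [MeasurableSpace Ω] [MeasurableSpace Ω']

theorem reCLM_compLp_toL2 {f : ℝ → ℝ} (hf : MemLp f 2 volume) :
    Complex.reCLM.compLp (toL2 fun u => (f u : ℂ)) = toL2 f := by
  apply Lp.ext
  filter_upwards [Complex.reCLM.coeFn_compLp (toL2 fun u => (f u : ℂ)),
    coeFn_toL2 (hf.ofReal (K := ℂ)), coeFn_toL2 hf] with u h1 h2 h3
  rw [h1, h3]
  erw [h2]
  simp

theorem imCLM_compLp_toL2 {f : ℝ → ℝ} (hf : MemLp f 2 volume) :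
    Complex.imCLM.compLp (toL2 fun u => (f u : ℂ)) = 0 := by
  apply Lp.ext
  filter_upwards [Complex.imCLM.coeFn_compLp (toL2 fun u => (f u : ℂ)),
    coeFn_toL2 (hf.ofReal (K := ℂ)), Lp.coeFn_zero ℝ 2 (volume : Measure ℝ)] with u h1 h2 h3
  rw [h1, h3]
  erw [h2]
  simp

/-- Linearity of η is not part of the definition of white noise, but the covariance gives η(0)
second moment 0. -/
theorem IsWhiteNoise.zero_ae {η : L2 ℝ → Ω → ℝ} {P : Measure Ω} (h : IsWhiteNoise η P) :
    ∀ᵐ ω ∂P, η 0 ω = 0 := by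
  have hmem := ((IsWhiteNoise.isGaussianProcess h).hasGaussianLaw_eval 0).memLp_two
  have hcov := h.covariance 0 0
  rw [inner_zero_left, integral_eq_zero_iff_of_nonneg (fun ω => mul_self_nonneg _)
    (by simpa only [sq] using hmem.integrable_sq)] at hcov
  filter_upwards [hcov] with ω hω
  exact mul_self_eq_zero.1 hω

/-- The transformed spectral kernel is the real moving-average kernel, so its imaginary part
contributes only η(0), which is almost surely 0. -/
theorem spectralMOU_ae_eq {η : L2 ℝ → Ω → ℝ} {P : Measure Ω} (h : IsWhiteNoise η P)
    {α : ℝ → ℝ} {lam : ℝ} (hlam : 0 < lam) (t : ℝ) (ht : 1 / 2 < α t) :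
    (fun ω => (movingAverageMOU α lam η t ω : ℂ)) =ᵐ[P] spectralMOU α lam η t := by
  filter_upwards [h.zero_ae] with ω hω
  have hk := memLp_movingAverageKernel t ht hlam
  rw [spectralMOU, spectralIntegral, unitaryFourier_spectralKernel t ht hlam,
    reCLM_compLp_toL2 hk, imCLM_compLp_toL2 hk, hω, movingAverageMOU, noiseIntegral]
  simp

theorem isGaussianProcess_movingAverageMOU {η : L2 ℝ → Ω → ℝ} {P : Measure Ω}
    (h : IsWhiteNoise η P) (α : ℝ → ℝ) (lam : ℝ) :
    IsGaussianProcess (movingAverageMOU α lam η) P :=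
  (IsWhiteNoise.isGaussianProcess h).comp_right fun t => toL2 (movingAverageKernel α lam t)

theorem isGaussianProcess_spectralMOU {η : L2 ℝ → Ω → ℝ} {P : Measure Ω}
    (h : IsWhiteNoise η P) {α : ℝ → ℝ} (hα : ∀ t, 1 / 2 < α t) {lam : ℝ} (hlam : 0 < lam) :
    IsGaussianProcess (spectralMOU α lam η) P :=
  ((isGaussianProcess_movingAverageMOU h α lam).comp_left
    fun _ => Complex.ofRealCLM).congr fun t => spectralMOU_ae_eq h hlam t (hα t)

theorem integral_movingAverageMOU_mul {η : L2 ℝ → Ω → ℝ} {P : Measure Ω}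
    (h : IsWhiteNoise η P) {α : ℝ → ℝ} (hα : ∀ t, 1 / 2 < α t) {lam : ℝ} (hlam : 0 < lam)
    (s t : ℝ) : ∫ ω, movingAverageMOU α lam η t ω * movingAverageMOU α lam η s ω ∂P
      = ∫ u, movingAverageKernel α lam t u * movingAverageKernel α lam s u := by
  rw [← inner_toL2_real (memLp_movingAverageKernel t (hα t) hlam)
    (memLp_movingAverageKernel s (hα s) hlam)]
  exact h.covariance _ _

theorem integral_spectralMOU_mul {η : L2 ℝ → Ω → ℝ} {P : Measure Ω}
    (h : IsWhiteNoise η P) {α : ℝ → ℝ} (hα : ∀ t, 1 / 2 < α t) {lam : ℝ} (hlam : 0 < lam)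
    (s t : ℝ) : ∫ ω, spectralMOU α lam η t ω * spectralMOU α lam η s ω ∂P
      = ((∫ u, movingAverageKernel α lam t u * movingAverageKernel α lam s u : ℝ) : ℂ) := by
  rw [← integral_movingAverageMOU_mul h hα hlam, ← integral_complex_ofReal]
  refine integral_congr_ae ?_
  filter_upwards [spectralMOU_ae_eq h hlam t (hα t), spectralMOU_ae_eq h hlam s (hα s)]
    with ω h1 h2
  rw [← h1, ← h2, Complex.ofReal_mul]

/-- Two centred Gaussian processes with the same covariance function have the same
finite-dimensional distributions. -/
theorem identDistrib_restrict_of_covariance_eq {T : Type*} {X : T → Ω → ℝ} {Y : T → Ω' → ℝ}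
    {P : Measure Ω} {P' : Measure Ω'} (hX : IsGaussianProcess X P) (hY : IsGaussianProcess Y P')
    (hX0 : ∀ t, ∫ ω, X t ω ∂P = 0) (hY0 : ∀ t, ∫ ω, Y t ω ∂P' = 0)
    (hXY : ∀ s t, ∫ ω, X t ω * X s ω ∂P = ∫ ω, Y t ω * Y s ω ∂P') (I : Finset T) :
    IdentDistrib (fun ω => I.restrict (X · ω)) (fun ω => I.restrict (Y · ω)) P P' := by
  classical
  have := hX.isProbabilityMeasure
  have := hY.isProbabilityMeasure
  have gX := hX.hasGaussianLaw I
  have gY := hY.hasGaussianLaw I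
  refine ⟨gX.aemeasurable, gY.aemeasurable, ?_⟩
  have := gX.isGaussian_map
  have := gY.isGaussian_map
  -- The characteristic function of a Gaussian law depends only on the mean and variance of each
  -- linear functional L, which expand through means and covariances of the coordinates.
  apply Measure.ext_of_charFunDual
  funext L
  rw [gX.charFunDual_map_eq_fun, gY.charFunDual_map_eq_fun]
  have hL : ∀ x : I → ℝ, L x = ∑ i, L (Pi.single i 1) * x i := by
    intro x
    conv_lhs => rw [pi_eq_sum_univ' x, map_sum]
    refine Finset.sum_congr rfl fun i _ => ?_
    rw [map_smul, smul_eq_mul, mul_comm]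
  have mX : ∀ t, MemLp (X t) 2 P := fun t => (hX.hasGaussianLaw_eval t).memLp_two
  have mY : ∀ t, MemLp (Y t) 2 P' := fun t => (hY.hasGaussianLaw_eval t).memLp_two
  have hcov : ∀ s t, cov[X s, X t; P] = cov[Y s, Y t; P'] := by
    intro s t
    rw [covariance_eq_sub (mX s) (mX t), covariance_eq_sub (mY s) (mY t), hX0, hY0]
    simpa using hXY t s
  have eX : (fun ω => L (I.restrict (X · ω)))
      = fun ω => ∑ i : I, L (Pi.single i 1) * X i ω := funext fun ω => hL _
  have eY : (fun ω => L (I.restrict (Y · ω)))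
      = fun ω => ∑ i : I, L (Pi.single i 1) * Y i ω := funext fun ω => hL _
  have mX' : ∀ i : I, MemLp (fun ω => L (Pi.single i 1) * X i ω) 2 P :=
    fun i => (mX i).const_mul _
  have mY' : ∀ i : I, MemLp (fun ω => L (Pi.single i 1) * Y i ω) 2 P' :=
    fun i => (mY i).const_mul _
  rw [eX, eY, integral_finsetSum _ fun i _ => (mX' i).integrable one_le_two,
    integral_finsetSum _ fun i _ => (mY' i).integrable one_le_two,
    variance_fun_sum mX', variance_fun_sum mY']
  simp_rw [integral_const_mul, hX0, hY0, covariance_const_mul_left, covariance_const_mul_right,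
    hcov]

/-- The moving-average processes of the two noises have the same law; the second then agrees almost
surely with the spectral process of η' on the finite index set. -/
theorem identDistrib_movingAverageMOU_spectralMOU {η : L2 ℝ → Ω → ℝ} {P : Measure Ω}
    {η' : L2 ℝ → Ω' → ℝ} {P' : Measure Ω'} (h : IsWhiteNoise η P) (h' : IsWhiteNoise η' P')
    {α : ℝ → ℝ} (hα : ∀ t, 1 / 2 < α t) {lam : ℝ} (hlam : 0 < lam) (I : Finset ℝ) :
    IdentDistrib (fun ω => I.restrict fun t => (movingAverageMOU α lam η t ω : ℂ))
      (fun ω => I.restrict fun t => spectralMOU α lam η' t ω) P P' := by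
  have h1 := identDistrib_restrict_of_covariance_eq
    (isGaussianProcess_movingAverageMOU h α lam) (isGaussianProcess_movingAverageMOU h' α lam)
    (fun t => h.mean_zero _) (fun t => h'.mean_zero _)
    (fun s t => by
      rw [integral_movingAverageMOU_mul h hα hlam, integral_movingAverageMOU_mul h' hα hlam]) I
  have h2 := h1.comp (u := fun (x : I → ℝ) (i : I) => (x i : ℂ)) (by fun_prop)
  have hae : (fun ω => I.restrict fun t => (movingAverageMOU α lam η' t ω : ℂ))
      =ᵐ[P'] fun ω => I.restrict fun t => spectralMOU α lam η' t ω := by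
    have : ∀ᵐ ω ∂P', ∀ i : I,
        (movingAverageMOU α lam η' i ω : ℂ) = spectralMOU α lam η' i ω :=
      ae_all_iff.2 fun i => spectralMOU_ae_eq h' hlam i (hα i)
    filter_upwards [this] with ω hω
    funext i
    exact hω i
  exact h2.trans (IdentDistrib.of_ae_eq h2.aemeasurable_snd hae)

end WhiteNoiseDriven

end MOU

theorem mainTheorem12 (α : ℝ → ℝ) (hα : ∀ t, 1 / 2 < α t) (lam : ℝ) (hlam : 0 < lam) :
    -- the relations between the special functions
    (∀ κ μ z : ℝ, 0 < z → MOU.whittakerW κ μ z = MOU.whittakerW κ (-μ) z) ∧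
    (∀ s t : ℝ, s < t →
      MOU.kummerU (α s) (2 * MOU.alphaPlus α s t) (2 * lam * (t - s))
        = Real.exp (lam * (t - s)) * (2 * lam * (t - s)) ^ (-MOU.alphaPlus α s t)
          * MOU.whittakerW (MOU.alphaMinus α s t) (MOU.alphaPlus α s t - 1 / 2)
              (2 * lam * (t - s))) ∧
    (∀ s t : ℝ, s < t → MOU.kummerForm α lam s t = MOU.whittakerForm α lam s t) ∧
    -- the kernels are square integrable, so that both processes are well defined
    (∀ t : ℝ, MemLp (MOU.movingAverageKernel α lam t) 2 (volume : Measure ℝ) ∧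
      MemLp (MOU.spectralKernel α lam t) 2 (volume : Measure ℝ)) ∧
    -- the two processes, driven by arbitrary white noises
    (∀ {Ω Ω' : Type*} [MeasurableSpace Ω] [MeasurableSpace Ω'] (P : Measure Ω) (P' : Measure Ω')
      (η : MOU.L2 ℝ → Ω → ℝ) (η' : MOU.L2 ℝ → Ω' → ℝ),
      MOU.IsWhiteNoise η P → MOU.IsWhiteNoise η' P' →
      -- both are centred Gaussian, and the second one is real-valued almost surely
      (IsGaussianProcess (MOU.movingAverageMOU α lam η) P ∧
        ∀ t, ∫ ω, MOU.movingAverageMOU α lam η t ω ∂P = 0) ∧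
      (IsGaussianProcess (MOU.spectralMOU α lam η') P' ∧
        (∀ t, ∫ ω, MOU.spectralMOU α lam η' t ω ∂P' = 0) ∧
        ∀ t, ∀ᵐ ω ∂P', (MOU.spectralMOU α lam η' t ω).im = 0) ∧
      -- covariance of the moving-average process
      (∀ s t : ℝ, ∫ ω, MOU.movingAverageMOU α lam η t ω * MOU.movingAverageMOU α lam η s ω ∂P
        = Real.exp (-lam * (t + s)) / (Real.Gamma (α t) * Real.Gamma (α s))
          * ∫ u in Set.Iio (min t s),
              (t - u) ^ (α t - 1) * (s - u) ^ (α s - 1) * Real.exp (2 * lam * u)) ∧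
      (∀ s t : ℝ, s < t →
        ∫ ω, MOU.movingAverageMOU α lam η t ω * MOU.movingAverageMOU α lam η s ω ∂P
          = MOU.kummerForm α lam s t) ∧
      -- covariance of the spectral process
      (∀ s t : ℝ, ∫ ω, MOU.spectralMOU α lam η' t ω * MOU.spectralMOU α lam η' s ω ∂P'
        = 1 / (2 * Real.pi) * ∫ k : ℝ, Complex.exp (-Complex.I * k * (t - s))
            / ((-Complex.I * k + lam) ^ (α t : ℂ) * (Complex.I * k + lam) ^ (α s : ℂ))) ∧
      (∀ s t : ℝ, s < t →
        ∫ ω, MOU.spectralMOU α lam η' t ω * MOU.spectralMOU α lam η' s ω ∂P'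
          = (MOU.whittakerForm α lam s t : ℂ)) ∧
      -- the two covariance functions agree
      (∀ s t : ℝ, ∫ ω, MOU.spectralMOU α lam η' t ω * MOU.spectralMOU α lam η' s ω ∂P'
        = ((∫ ω, MOU.movingAverageMOU α lam η t ω * MOU.movingAverageMOU α lam η s ω ∂P : ℝ) :
            ℂ)) ∧
      -- and the two processes have the same finite-dimensional distributions
      (∀ I : Finset ℝ,
        IdentDistrib (fun ω => I.restrict fun t => (MOU.movingAverageMOU α lam η t ω : ℂ))
          (fun ω => I.restrict fun t => MOU.spectralMOU α lam η' t ω) P P')) := by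
  refine ⟨fun κ μ z hz => MOU.whittakerW_neg κ μ hz,
    fun s t hst => MOU.kummerU_eq_whittakerW α hlam hst,
    fun s t hst => MOU.kummerForm_eq_whittakerForm α hlam hst,
    fun t => ⟨MOU.memLp_movingAverageKernel t (hα t) hlam,
      MOU.memLp_spectralKernel t (hα t) hlam⟩, ?_⟩
  intro Ω Ω' _ _ P P' η η' h h'
  refine ⟨⟨MOU.isGaussianProcess_movingAverageMOU h α lam, fun t => h.mean_zero _⟩,
    ⟨MOU.isGaussianProcess_spectralMOU h' hα hlam, fun t => ?_, fun t => ?_⟩,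
    fun s t => ?_, fun s t hst => ?_, fun s t => ?_, fun s t hst => ?_, fun s t => ?_,
    MOU.identDistrib_movingAverageMOU_spectralMOU h h' hα hlam⟩
  · rw [← integral_congr_ae (MOU.spectralMOU_ae_eq h' hlam t (hα t)), integral_complex_ofReal]
    exact congrArg _ (h'.mean_zero _)
  · filter_upwards [MOU.spectralMOU_ae_eq h' hlam t (hα t)] with ω hω
    rw [← hω, Complex.ofReal_im]
  · rw [MOU.integral_movingAverageMOU_mul h hα hlam, MOU.integral_movingAverageKernel_mul]
  · rw [MOU.integral_movingAverageMOU_mul h hα hlam,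
      MOU.integral_movingAverageKernel_mul_of_lt (by linarith [hα s]) hlam hst]
  · rw [MOU.integral_spectralMOU_mul h' hα hlam, MOU.integral_spectral_eq s t (hα s) (hα t) hlam]
  · rw [MOU.integral_spectralMOU_mul h' hα hlam,
      MOU.integral_movingAverageKernel_mul_of_lt (by linarith [hα s]) hlam hst,
      MOU.kummerForm_eq_whittakerForm α hlam hst]
  · rw [MOU.integral_spectralMOU_mul h' hα hlam, MOU.integral_movingAverageMOU_mul h hα hlam]
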